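/- Let $\mathfrak H$ be a separable complex Hilbert space with inner product $\langle\cdot,\cdot\rangle$ linear in the first argument, equipped with a complex conjugation $h\mapsto\bar h$ (an antilinear isometric involution), and let $\{e_k\}$ be a complete orthonormal system of $\mathfrak H$. Let $Z=\{Z(h):h\in\mathfrak H\}$ be a complex Gaussian isonormal process on a probability space $(\Omega,\mathcal F,P)$: a centered jointly Gaussian family of complex random variables with $\mathbb E[Z(h)^2]=0$ and $\mathbb E[Z(g)\overline{Z(h)}]=\langle g,h\rangle$ for all $g,h\in\mathfrak H$. For integers $m,n\ge 0$ let $J_{m,n}(z)=\sum_{r=0}^{m\wedge n}(-1)^r r!\binom mr\binom nr z^{m-r}\bar z^{\,n-r}2^r$, and for finitely supported multi-indices $\mathbf m=(m_k),\mathbf n=(n_k)$ with $|\mathbf m|=m$, $|\mathbf n|=n$ put $\mathbf J_{\mathbf m,\mathbf n}=\prod_k (2^{m_k+n_k}m_k!\,n_k!)^{-1/2}J_{m_k,n_k}(\sqrt2\,Z(e_k))$. Let $\mathfrak H^{\odot m}$ denote the $m$-th symmetric Hilbert tensor power of $\mathfrak H$. The multiple Wiener–Itô integral $I_{m,n}:\mathfrak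 H^{\odot m}\otimes\mathfrak H^{\odot n}\to L^2(\Omega)$ is the continuous linear map with $$I_{m,n}\big((\hat\otimes_k e_k^{\otimes m_k})\otimes(\hat\otimes_k \bar e_k^{\otimes n_k})\big)=\sqrt{\mathbf m!\,\mathbf n!}\;\mathbf J_{\mathbf m,\mathbf n},$$ where $\hat\otimes$ is the symmetrized tensor product. Let $D$ be the complex Malliavin derivative: for $g:\mathbb C^k\to\mathbb C$ of class $C^\infty$ (in the real sense) such that $g$ and all its partial derivatives have polynomial growth, and $h_1,\dots,h_k\in\mathfrak H$, $$D\,g(Z(h_1),\dots,Z(h_k))=\sum_{j=1}^k\frac{\partial g}{\partial z_j}(Z(h_1),\dots,Z(h_k))\,h_j ,$$ with $\partial/\partial z_j$ the Wirtinger derivative; this operator is extended to its closure from $L^2(\Omega)$ to $L^2(\Omega;\mathfrak H)$, whose domain is denoted $\mathbb D^{1,2}$. **Proposition.** Let $m\ge1$, $n\ge0$, $f\in\mathfrak H^{\odot m}\otimes\mathfrak H^{\odot n}$ and $F=I_{m,n}(f)$. Then $F,\bar F\in\mathbb D^{1,2}$, the random variables $|F|^4$, $\|DF\|_{\mathfrak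 H}^2|F|^2$ and $\langle DF,D\bar F\rangle_{\mathfrak H}\,\bar F^2$ are integrable, and $$\mathbb E\big[|F|^4\big]=\frac1m\,\mathbb E\Big[2\,\|DF\|_{\mathfrak H}^2\,|F|^2+\langle DF,D\bar F\rangle_{\mathfrak H}\,\bar F^{2}\Big].$$ -/

import Mathlib

open MeasureTheory ProbabilityTheory
open scoped ENNReal TensorProduct Nat

universe u

noncomputable section

namespace ComplexWiener

/-! ### Hilbert tensor powers -/

/-- A complex Hilbert space, bundled (used only to define tensor powers by recursion). -/
structure HilbertObj : Type (u + 1) where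
  carrier : Type u
  [instNACG : NormedAddCommGroup carrier]
  [instIPS : InnerProductSpace ℂ carrier]
  [instComplete : CompleteSpace carrier]

attribute [instance] HilbertObj.instNACG HilbertObj.instIPS HilbertObj.instComplete

section Tensor

variable (H : Type u) [NormedAddCommGroup H] [InnerProductSpace ℂ H]

/-- `H^{⊗0}` is the one-dimensional Hilbert space `ℂ` (placed in the universe of `H`), and
`H^{⊗(k+1)}` is the Hilbert space completion of `H ⊗ H^{⊗k}`, where
`⟪a ⊗ b, c ⊗ d⟫ = ⟪a, c⟫ ⟪b, d⟫`. -/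
def tensorPowerObj : ℕ → HilbertObj.{u}
  | 0 => ⟨EuclideanSpace ℂ PUnit.{u + 1}⟩
  | k + 1 => ⟨UniformSpace.Completion (H ⊗[ℂ] (tensorPowerObj k).carrier)⟩

/-- The `k`-th Hilbert tensor power `H^{⊗k}`. -/
def HTensor (k : ℕ) : Type u := (tensorPowerObj H k).carrier

instance (k : ℕ) : NormedAddCommGroup (HTensor H k) := (tensorPowerObj H k).instNACG
instance (k : ℕ) : InnerProductSpace ℂ (HTensor H k) := (tensorPowerObj H k).instIPS
instance (k : ℕ) : CompleteSpace (HTensor H k) := (tensorPowerObj H k).instComplete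

variable {H}

/-- The elementary tensor `v 0 ⊗ v 1 ⊗ ⋯ ⊗ v (k-1)` in `H^{⊗k}`. -/
def pureTensor : (k : ℕ) → (Fin k → H) → HTensor H k
  | 0, _ => EuclideanSpace.single PUnit.unit (1 : ℂ)
  | k + 1, v => ((v 0 ⊗ₜ[ℂ] pureTensor k (Fin.tail v) : H ⊗[ℂ] HTensor H k) :
      UniformSpace.Completion (H ⊗[ℂ] HTensor H k))

theorem inner_pureTensor : ∀ (k : ℕ) (v w : Fin k → H),
    inner ℂ (pureTensor k v) (pureTensor k w) = ∏ i, inner ℂ (v i) (w i)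
  | 0, _, _ => by
    change inner ℂ (EuclideanSpace.single PUnit.unit (1 : ℂ) : EuclideanSpace ℂ PUnit.{u + 1})
      (EuclideanSpace.single PUnit.unit (1 : ℂ)) = _
    simp
  | k + 1, v, w => by
    rw [Fin.prod_univ_succ]
    change inner ℂ ((v 0 ⊗ₜ[ℂ] pureTensor k (Fin.tail v) : H ⊗[ℂ] HTensor H k) :
      UniformSpace.Completion (H ⊗[ℂ] HTensor H k)) ((w 0 ⊗ₜ[ℂ] pureTensor k (Fin.tail w) :
      H ⊗[ℂ] HTensor H k) : UniformSpace.Completion (H ⊗[ℂ] HTensor H k)) = _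
    rw [UniformSpace.Completion.inner_coe, TensorProduct.inner_tmul,
      inner_pureTensor k (Fin.tail v) (Fin.tail w)]
    rfl

/-- The tensor `(v₁ ⊗̂ ⋯ ⊗̂ v_m) ⊗ (w₁ ⊗̂ ⋯ ⊗̂ w_n)`, where `⊗̂` is the symmetrized tensor product:
`(1 / (m! n!)) ∑_π ∑_σ v_{π 1} ⊗ ⋯ ⊗ v_{π m} ⊗ w_{σ 1} ⊗ ⋯ ⊗ w_{σ n}`. -/
def symTensor {m n : ℕ} (v : Fin m → H) (w : Fin n → H) : HTensor H (m + n) :=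
  ((m ! * n ! : ℕ) : ℂ)⁻¹ • ∑ π : Equiv.Perm (Fin m), ∑ σ : Equiv.Perm (Fin n),
    pureTensor (m + n) (Fin.append (v ∘ π) (w ∘ σ))

variable (H) in
/-- The Hilbert space `H^{⊙m} ⊗ H^{⊙n}`, as a closed subspace of `H^{⊗(m+n)}`. -/
def symKernels (m n : ℕ) : Submodule ℂ (HTensor H (m + n)) :=
  (Submodule.span ℂ
    (Set.range fun p : (Fin m → H) × (Fin n → H) => symTensor p.1 p.2)).topologicalClosure

end Tensor

/-! ### Complex isonormal processes and complex Hermite polynomials -/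

variable {H : Type u} [NormedAddCommGroup H] [InnerProductSpace ℂ H]
  {Ω : Type*} [MeasurableSpace Ω]

/-- `Z = {Z(h) : h ∈ H}` is a complex Gaussian isonormal process: a centred family of complex
random variables, jointly Gaussian (as `ℝ²`-valued variables), with `E[Z(h)²] = 0` and
`E[Z(g) conj Z(h)] = ⟨g, h⟩`, where `⟨g, h⟩` is linear in `g` (it is `inner ℂ h g` in Mathlib). -/
structure IsComplexIsonormal (Z : H → Ω → ℂ) (P : Measure Ω) : Prop where
  gaussian : IsGaussianProcess Z P
  centered : ∀ h, ∫ ω, Z h ω ∂P = 0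
  sq : ∀ h, ∫ ω, Z h ω ^ 2 ∂P = 0
  covariance : ∀ g h, ∫ ω, Z g ω * starRingEnd ℂ (Z h ω) ∂P = inner ℂ h g

/-- The complex Hermite polynomial `J_{m,n}(z, ρ)`. -/
def complexHermite (m n : ℕ) (z : ℂ) (ρ : ℝ) : ℂ :=
  ∑ r ∈ Finset.range (min m n + 1), (-1) ^ r * (r ! : ℂ) * (m.choose r : ℂ) * (n.choose r : ℂ)
    * z ^ (m - r) * starRingEnd ℂ z ^ (n - r) * (ρ : ℂ) ^ r

section Integral

variable {ι : Type*}

open Classical in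
/-- The Fourier-Hermite polynomial
`𝐉_{a,b} = ∏_k (2^{a_k+b_k} a_k! b_k!)^{-1/2} J_{a_k,b_k}(√2 Z(e_k), 2)`; the factors with
`a_k = b_k = 0` are `1`. -/
def fourierHermite (Z : H → Ω → ℂ) (e : ι → H) (a b : ι →₀ ℕ) (ω : Ω) : ℂ :=
  ∏ k ∈ a.support ∪ b.support,
    ((Real.sqrt ((2 ^ (a k + b k) * (a k)! * (b k)! : ℕ) : ℝ))⁻¹ : ℂ)
      * complexHermite (a k) (b k) ((Real.sqrt 2 : ℂ) * Z (e k) ω) 2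

theorem memLp_mul_of_forall {P : Measure Ω} {X Y : Ω → ℂ}
    (hX : ∀ p : ℝ≥0∞, p ≠ ∞ → MemLp X p P) (hY : ∀ p : ℝ≥0∞, p ≠ ∞ → MemLp Y p P)
    (p : ℝ≥0∞) (hp : p ≠ ∞) : MemLp (fun ω => X ω * Y ω) p P := by
  have h2 : (2 : ℝ≥0∞) * p ≠ ∞ := ENNReal.mul_ne_top (by simp) hp
  have : ENNReal.HolderTriple (2 * p) (2 * p) p := ⟨by
    rw [ENNReal.mul_inv (by simp) (by simp), ← add_mul, ENNReal.inv_two_add_inv_two, one_mul]⟩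
  exact (hY _ h2).mul (hX _ h2)

theorem memLp_pow_of_forall {P : Measure Ω} [IsProbabilityMeasure P] {X : Ω → ℂ}
    (hX : ∀ p : ℝ≥0∞, p ≠ ∞ → MemLp X p P) (k : ℕ) :
    ∀ p : ℝ≥0∞, p ≠ ∞ → MemLp (fun ω => X ω ^ k) p P := by
  induction k with
  | zero => intro p _; simpa using memLp_const (1 : ℂ)
  | succ k ih => simpa only [pow_succ] using memLp_mul_of_forall ih hX

theorem memLp_fourierHermite {P : Measure Ω} {Z : H → Ω → ℂ} (hZ : IsComplexIsonormal Z P)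
    (e : ι → H) (a b : ι →₀ ℕ) : MemLp (fourierHermite Z e a b) 2 P := by
  classical
  have := hZ.gaussian.isProbabilityMeasure
  have hc : ∀ (c : ℂ) (p : ℝ≥0∞), p ≠ ∞ → MemLp (fun _ : Ω => c) p P :=
    fun c p _ => memLp_const c
  have hJ : ∀ k, ∀ p : ℝ≥0∞, p ≠ ∞ → MemLp (fun ω =>
      complexHermite (a k) (b k) ((Real.sqrt 2 : ℂ) * Z (e k) ω) 2) p P := by
    intro k p hp
    have hX : ∀ p : ℝ≥0∞, p ≠ ∞ → MemLp (fun ω => (Real.sqrt 2 : ℂ) * Z (e k) ω) p P :=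
      fun p hp => ((hZ.gaussian.hasGaussianLaw_eval (e k)).memLp hp).const_mul _
    have hY : ∀ p : ℝ≥0∞, p ≠ ∞ →
        MemLp (fun ω => starRingEnd ℂ ((Real.sqrt 2 : ℂ) * Z (e k) ω)) p P :=
      fun p hp => (hX p hp).star
    unfold complexHermite
    refine memLp_finsetSum _ fun r _ => ?_
    exact memLp_mul_of_forall (memLp_mul_of_forall (memLp_mul_of_forall (hc _)
      (memLp_pow_of_forall hX _)) (memLp_pow_of_forall hY _)) (hc _) p hp
  have key : ∀ s : Finset ι, ∀ p : ℝ≥0∞, p ≠ ∞ → MemLp (fun ω => ∏ k ∈ s,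
      ((Real.sqrt ((2 ^ (a k + b k) * (a k)! * (b k)! : ℕ) : ℝ))⁻¹ : ℂ)
      * complexHermite (a k) (b k) ((Real.sqrt 2 : ℂ) * Z (e k) ω) 2) p P := by
    intro s
    induction s using Finset.induction_on with
    | empty => intro p hp; simpa using hc 1 p hp
    | insert k s hk ih =>
      simp only [Finset.prod_insert hk]
      exact memLp_mul_of_forall (memLp_mul_of_forall (hc _) (hJ k)) ih
  exact key _ 2 (by simp)

/-- The multi-index counting how often each element of `ι` occurs in the list `j`. -/
def multiIndex {k : ℕ} (j : Fin k → ι) : ι →₀ ℕ := ∑ i, Finsupp.single (j i) 1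

/-- `a! = ∏_k a_k!`. -/
def multiFactorial (a : ι →₀ ℕ) : ℕ := a.prod fun _ c => c !

variable [CompleteSpace H]

/-- The complex multiple Wiener-Itô integral `I_{m,n}(f)` with respect to `Z`.
With `ē = conj e` and the expansion
`f = ∑_{j,l} ⟨f, e_{j 1} ⊗ ⋯ ⊗ e_{j m} ⊗ ē_{l 1} ⊗ ⋯ ⊗ ē_{l n}⟩ e_{j 1} ⊗ ⋯ ⊗ ē_{l n}`,
it is the continuous linear extension of the rule that sends the symmetrization
`(e_{j 1} ⊗̂ ⋯ ⊗̂ e_{j m}) ⊗ (ē_{l 1} ⊗̂ ⋯ ⊗̂ ē_{l n})` of a basis tensor to `√(a! b!) 𝐉_{a,b}`,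
where `a`, `b` are the multiplicities of `j`, `l`. The series converges unconditionally in
`L²(Ω)`. -/
def wienerIto {P : Measure Ω} {Z : H → Ω → ℂ} (hZ : IsComplexIsonormal Z P)
    (conj : H ≃ₗᵢ⋆[ℂ] H) (e : HilbertBasis ι ℂ H) (m n : ℕ) (f : HTensor H (m + n)) :
    Lp ℂ 2 P :=
  ∑' p : (Fin m → ι) × (Fin n → ι),
    ((inner ℂ (pureTensor (m + n)
        (Fin.append (fun i => e (p.1 i)) (fun i => conj (e (p.2 i))))) f
      * (Real.sqrt ((multiFactorial (multiIndex p.1) * multiFactorial (multiIndex p.2) : ℕ)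
          : ℝ) : ℂ)) : ℂ)
      • (memLp_fourierHermite hZ e (multiIndex p.1) (multiIndex p.2)).toLp
          (fourierHermite Z e (multiIndex p.1) (multiIndex p.2))

end Integral

/-! ### The complex Malliavin derivative -/

/-- The Wirtinger derivative `∂g/∂z_j = (∂g/∂x_j - i ∂g/∂y_j) / 2`. -/
def wirtinger {k : ℕ} (g : (Fin k → ℂ) → ℂ) (j : Fin k) (z : Fin k → ℂ) : ℂ :=
  (fderiv ℝ g z (Pi.single j 1) - Complex.I * fderiv ℝ g z (Pi.single j Complex.I)) / 2

/-- The graph of `D` on smooth random variables: the pairs `(F, DF)` in `L²(Ω) × L²(Ω; H)` with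
`F = g(Z(h_1), …, Z(h_k))` and `DF = ∑_j ∂_j g(Z(h_1), …, Z(h_k)) h_j`, where `g` is smooth (in the
real sense) and `g` and all its derivatives have polynomial growth. -/
def smoothGraph (Z : H → Ω → ℂ) (P : Measure Ω) : Set (Lp ℂ 2 P × Lp H 2 P) :=
  {q | ∃ (k : ℕ) (g : (Fin k → ℂ) → ℂ) (h : Fin k → H), g.HasTemperateGrowth ∧
    (q.1 =ᵐ[P] fun ω => g fun i => Z (h i) ω) ∧
    (q.2 =ᵐ[P] fun ω => ∑ j, wirtinger g j (fun i => Z (h i) ω) • h j)}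

/-- `F ∈ 𝔻^{1,2}` with Malliavin derivative `u`: `(F, u)` is a limit in `L²(Ω) × L²(Ω; H)` of
pairs `(F_k, DF_k)` with `F_k` smooth. -/
def HasMalliavinDeriv (Z : H → Ω → ℂ) (P : Measure Ω) (F : Lp ℂ 2 P) (u : Lp H 2 P) : Prop :=
  (F, u) ∈ closure (smoothGraph Z P)

/-- The domain `𝔻^{1,2}` of `D`. -/
def malliavinDomain (Z : H → Ω → ℂ) (P : Measure Ω) : Set (Lp ℂ 2 P) :=
  {F | ∃ u, HasMalliavinDeriv Z P F u}

open Classical in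
/-- The complex Malliavin derivative `DF ∈ L²(Ω; H)` of `F ∈ 𝔻^{1,2}` (and `0` off `𝔻^{1,2}`). -/
def malliavinD (Z : H → Ω → ℂ) (P : Measure Ω) (F : Lp ℂ 2 P) : Lp H 2 P :=
  if h : ∃ u, HasMalliavinDeriv Z P F u then h.choose else 0

end ComplexWiener

end

/-! On the `(m, n)`-th chaos the operator `D*D` is multiplication by `m`, that is, `E⟨DF, DG⟩ = m
E[F conj G]`. With `G = F² conj F` the right side is `m E|F|⁴`. Since `DG = 2|F|² DF + F² D(conj
F)`, the left side is the claimed expectation. (Here `⟨·,·⟩` is linear in its first slot, the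
reverse of `inner ℂ`.)

For polynomials in finitely many `Z (e i)` and their conjugates this is algebra plus Gaussian
integration by parts. The `L²`-adjoint of `∂_i` is `z_i - ∂̄_i`, so `D*D` is the number operator `∑
(z_i ∂_i - ∂̄_i ∂_i)`. Products of complex Hermite polynomials are its eigenvectors
(`number_of_mem_chaos`, `sum_polyExp_dz`, `fourth_moment_polyVar`).

A general `F` is only an `L²`-limit of such polynomials, while both sides are quartic. On a fixed
chaos, however, the `L⁴` norms of `p`, `Dp` and `D(conj p)` are all bounded by the `L²` norm of `p`.
This hypercontractivity follows from the identity itself, by induction on `m + n`: Young's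
inequality bounds `E|p|⁴` by the fourth moments of `Dp` and `D(conj p)`, whose coordinates lie in
chaoses of total degree one less (`exists_hypercontractive`). Hence `L²` convergence inside a chaos
upgrades to `L⁴` convergence of all three objects, and the identity, a closed condition in `L⁴`,
passes to the limit (`exists_of_mem_closure_chaos`).

Integration by parts also makes `D` closable, so the limit of the gradients is the derivative
(`HasMalliavinDeriv.unique`). -/

noncomputable section

namespace ComplexWiener


/-! ### Gaussian integration by parts on a real Banach space. -/

section Stein

variable {E F : Type*} [NormedAddCommGroup E] [NormedSpace ℝ E]
  [NormedAddCommGroup F] [NormedSpace ℝ F]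

/-- The derivative of a function of temperate growth has temperate growth. -/
theorem hasTemperateGrowth_fderiv {g : E → F} (hg : g.HasTemperateGrowth) :
    (fderiv ℝ g).HasTemperateGrowth := by
  refine ⟨hg.1.fderiv_right (m := (⊤ : ℕ∞)) (by simp), fun n => ?_⟩
  obtain ⟨k, C, h⟩ := hg.2 (n + 1)
  exact ⟨k, C, fun x => by rw [norm_iteratedFDeriv_fderiv]; exact h x⟩

theorem hasTemperateGrowth_fderiv_apply {g : E → F} (hg : g.HasTemperateGrowth) (v : E) :
    (fun x => fderiv ℝ g x v).HasTemperateGrowth :=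
  ((ContinuousLinearMap.apply ℝ F v).hasTemperateGrowth).comp (hasTemperateGrowth_fderiv hg)

theorem memLp_comp_of_hasTemperateGrowth {Ω : Type*} [MeasurableSpace Ω] {P : Measure Ω}
    [IsProbabilityMeasure P] {X : Ω → E} (hX : ∀ p : ℝ≥0∞, p ≠ ∞ → MemLp X p P) {g : E → F}
    (hg : g.HasTemperateGrowth) (p : ℝ≥0∞) (hp : p ≠ ∞) : MemLp (fun ω => g (X ω)) p P := by
  obtain ⟨k, C, h⟩ := hg.2 0
  have h1 : ∀ p : ℝ≥0∞, p ≠ ∞ → MemLp (fun ω => ((1 + ‖X ω‖ : ℝ) : ℂ)) p P := fun p hp =>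
    (((memLp_const (1 : ℝ)).add (hX p hp).norm).ofReal (K := ℂ))
  refine MemLp.of_le_mul (c := C) (memLp_pow_of_forall h1 k p hp)
    (hg.1.continuous.comp_aestronglyMeasurable (hX 0 (by simp)).1) (.of_forall fun ω => ?_)
  have := h (X ω)
  rw [norm_iteratedFDeriv_zero] at this
  rw [norm_pow, Complex.norm_real, Real.norm_of_nonneg (by positivity)]
  exact this

/-- **Stein's lemma** for a centred real Gaussian variable. -/
theorem integral_mul_gaussianReal {v : NNReal} (hv : v ≠ 0) {f : ℝ → ℂ}
    (hf : f.HasTemperateGrowth) :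
    ∫ y, (y : ℂ) * f y ∂gaussianReal 0 v = v * ∫ y, deriv f y ∂gaussianReal 0 v := by
  have hid : ∀ p : ℝ≥0∞, p ≠ ∞ → MemLp (fun y : ℝ => y) p (gaussianReal 0 v) :=
    fun p hp => memLp_id_gaussianReal' p hp
  have hint : ∀ ψ : ℝ → ℂ, ψ.HasTemperateGrowth →
      Integrable (fun y => ψ y * (gaussianPDFReal 0 v y : ℂ)) := by
    intro ψ hψ
    have h := memLp_one_iff_integrable.1
      (memLp_comp_of_hasTemperateGrowth hid hψ 1 (by simp))
    rw [gaussianReal_of_var_ne_zero _ hv, integrable_withDensity_iff_integrable_smul'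
      (measurable_gaussianPDF 0 v) (.of_forall fun _ => gaussianPDF_lt_top)] at h
    refine h.congr (.of_forall fun y => ?_)
    simp [toReal_gaussianPDF, mul_comm]
  have hderiv : deriv f = fun y => fderiv ℝ f y 1 := by ext; simp
  have hf' : (deriv f).HasTemperateGrowth := by
    rw [hderiv]; exact hasTemperateGrowth_fderiv_apply hf 1
  have hyf : (fun y : ℝ => (y : ℂ) * f y).HasTemperateGrowth :=
    Complex.ofRealCLM.hasTemperateGrowth.mul hf
  have hpdf : ∀ y : ℝ, HasDerivAt (fun y => (gaussianPDFReal 0 v y : ℂ))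
      (-(v : ℂ)⁻¹ * y * gaussianPDFReal 0 v y) y := by
    intro y
    have : HasDerivAt (gaussianPDFReal 0 v) (-(v : ℝ)⁻¹ * y * gaussianPDFReal 0 v y) y := by
      have hv' : (v : ℝ) ≠ 0 := by exact_mod_cast hv
      have h := ((((hasDerivAt_id y).pow 2).neg.div_const (2 * (v : ℝ))).exp).const_mul
        (Real.sqrt (2 * Real.pi * v))⁻¹
      convert! h using 1
      · ext; simp [gaussianPDFReal]
      · simp [gaussianPDFReal]; field_simp
    convert! this.ofReal_comp using 1
    push_cast; ring
  have key := integral_mul_deriv_eq_deriv_mul_of_integrable (u := f) (u' := deriv f)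
    (v := fun y => (gaussianPDFReal 0 v y : ℂ))
    (v' := fun y => -(v : ℂ)⁻¹ * y * gaussianPDFReal 0 v y)
    (fun x _ => (hf.1.differentiable (by simp) x).hasDerivAt) (fun x _ => hpdf x)
    (((hint _ hyf).const_mul (-(v : ℂ)⁻¹)).congr (.of_forall fun y => by simp; ring))
    (hint _ hf') (hint _ hf)
  rw [integral_gaussianReal_eq_integral_smul hv, integral_gaussianReal_eq_integral_smul hv]
  have hv' : (v : ℂ) ≠ 0 := by exact_mod_cast hv
  have e1 : ∫ y : ℝ, gaussianPDFReal 0 v y • ((y : ℂ) * f y)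
      = -(v : ℂ) * ∫ y : ℝ, f y * (-(v : ℂ)⁻¹ * y * gaussianPDFReal 0 v y) := by
    rw [← integral_const_mul]
    congr 1; ext y
    simp only [Complex.real_smul]; field_simp
  rw [e1, key]
  simp only [Complex.real_smul, mul_comm]
  ring

/-- **Gaussian integration by parts** for a Gaussian measure on a Banach space. -/
theorem integral_dual_mul_of_isGaussian [CompleteSpace E] [SecondCountableTopology E]
    [MeasurableSpace E] [BorelSpace E] (μ : Measure E) [IsGaussian μ] (L : StrongDual ℝ E)
    (hL : ∫ x, L x ∂μ = 0) {g : E → ℂ} (hg : g.HasTemperateGrowth) :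
    ∫ x, (L x : ℂ) * g x ∂μ = ∫ x, fderiv ℝ g x (∫ y, L y • y ∂μ) ∂μ := by
  have hid : ∀ p : ℝ≥0∞, p ≠ ∞ → MemLp (fun y : E => y) p μ := fun p hp =>
    IsGaussian.memLp_id μ p hp
  have hL2 : Integrable (fun y => L y • y) μ :=
    memLp_one_iff_integrable.1 ((hid 2 (by simp)).smul (p := 2) (q := 2)
      (IsGaussian.memLp_dual μ L 2 (by simp)))
  have hlaw := IsGaussian.map_eq_gaussianReal (μ := μ) L
  rw [hL] at hlaw
  set v := Var[L; μ].toNNReal with hv_def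
  have hvar : ∫ x, L x ^ 2 ∂μ = v := by
    rw [hv_def, Real.coe_toNNReal _ (variance_nonneg _ _), variance_eq_integral
      L.continuous.aemeasurable, hL]
    simp
  -- If `L` has variance zero then `L = 0` almost everywhere, and both sides vanish.
  by_cases hv : v = 0
  · have h0 : ∀ᵐ x ∂μ, L x = 0 := by
      have : (fun x => L x ^ 2) =ᵐ[μ] 0 := by
        rw [← integral_eq_zero_iff_of_nonneg (fun x => sq_nonneg _)
          (IsGaussian.memLp_dual μ L 2 (by simp)).integrable_sq, hvar, hv]; rfl
      filter_upwards [this] with x hx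
      simpa using hx
    have h1 : ∫ y, L y • y ∂μ = 0 := by
      rw [← integral_zero E E (μ := μ)]
      exact integral_congr_ae (h0.mono fun x hx => by simp [hx])
    rw [h1]
    simp only [map_zero, integral_zero]
    rw [← integral_zero E ℂ (μ := μ)]
    exact integral_congr_ae (h0.mono fun x hx => by simp [hx])
  set d := ∫ y, L y • y ∂μ with hd
  have hv' : (v : ℝ) ≠ 0 := by exact_mod_cast hv
  -- Gaussian regression: `x = T x + L x • c`, where `c` is chosen so that `T` and `L` are
  -- uncorrelated. Being jointly Gaussian, they are independent, and Fubini reduces the claim to one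
  -- dimension.
  set c := (v : ℝ)⁻¹ • d with hc
  have hdc : d = (v : ℝ) • c := by rw [hc, smul_smul, mul_inv_cancel₀ hv', one_smul]
  set T : E →L[ℝ] E := ContinuousLinearMap.id ℝ E - L.smulRight c with hT
  have hTL : HasGaussianLaw (fun x => (T x, L x)) μ :=
    (IsGaussian.hasGaussianLaw_id (μ := μ)).map_fun (T.prod L)
  have hind : IndepFun T L μ := by
    refine hTL.indepFun_of_covariance_strongDual fun L₁ L₂ => ?_
    have e2 : ∀ t : ℝ, L₂ t = t * L₂ 1 := fun t => by
      rw [← smul_eq_mul, ← L₂.map_smul]; simp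
    rw [covariance_eq_sub]
    · have m1 : ∫ x, (L₂ ∘ L) x ∂μ = 0 := by
        simp only [Function.comp_apply]
        simp_rw [fun x => e2 (L x)]
        rw [integral_mul_const, hL, zero_mul]
      have m2 : ∫ x, ((L₁ ∘ T) * (L₂ ∘ L)) x ∂μ = 0 := by
        have : ((L₁ ∘ T) * (L₂ ∘ L)) = fun x => L₁ (L x • x) * L₂ 1 - L x ^ 2 * (L₁ c * L₂ 1) := by
          ext x
          simp [hT, e2 (L x)]
          ring
        rw [this, integral_sub, integral_mul_const, integral_mul_const, hvar,
          L₁.integral_comp_comm hL2, ← hd, hdc]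
        · simp; ring
        · exact (L₁.integrable_comp hL2).mul_const _
        · exact (IsGaussian.memLp_dual μ L 2 (by simp)).integrable_sq.mul_const _
      rw [m1, m2]; simp
    · exact (hTL.fst.map L₁).memLp_two
    · exact (hTL.snd.map L₂).memLp_two
  have hmap : μ.map (fun x => (T x, L x)) = (μ.map T).prod (gaussianReal 0 v) := by
    rw [← hlaw]
    exact (indepFun_iff_map_prod_eq_prod_map_map T.continuous.aemeasurable
      L.continuous.aemeasurable).1 hind
  have : IsProbabilityMeasure (μ.map T) :=
    Measure.isProbabilityMeasure_map T.continuous.aemeasurable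
  have hTc : ∀ x, T x + L x • c = x := fun x => by simp [hT]
  have hfub : ∀ G : E × ℝ → ℂ, Continuous G → Integrable (fun x => G (T x, L x)) μ →
      ∫ x, G (T x, L x) ∂μ = ∫ t, ∫ y, G (t, y) ∂gaussianReal 0 v ∂μ.map T := by
    intro G hG hi
    have hm : AEMeasurable (fun x => (T x, L x)) μ := (T.prod L).continuous.aemeasurable
    rw [← integral_map hm (f := G) hG.aestronglyMeasurable, hmap, integral_prod]
    rw [← hmap, integrable_map_measure hG.aestronglyMeasurable hm]
    exact hi
  have hg' := hasTemperateGrowth_fderiv_apply hg d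
  have hLid : (fun x => (L x : ℂ) * g x).HasTemperateGrowth :=
    (Complex.ofRealCLM.hasTemperateGrowth.comp L.hasTemperateGrowth).mul hg
  have f1 := hfub (fun q => (q.2 : ℂ) * g (q.1 + q.2 • c))
    (by have := hg.1.continuous; fun_prop)
    (by
      simp only [hTc]
      exact memLp_one_iff_integrable.1 (memLp_comp_of_hasTemperateGrowth hid hLid 1 (by simp)))
  have f2 := hfub (fun q => fderiv ℝ g (q.1 + q.2 • c) d)
    (by have := hg'.1.continuous; fun_prop)
    (by
      simp only [hTc]
      exact memLp_one_iff_integrable.1 (memLp_comp_of_hasTemperateGrowth hid hg' 1 (by simp)))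
  simp only [hTc] at f1 f2
  rw [f1, f2]
  congr 1
  ext t
  have haff : (fun y : ℝ => t + y • c).HasTemperateGrowth :=
    (Function.HasTemperateGrowth.const t).add
      ((ContinuousLinearMap.id ℝ ℝ).smulRight c).hasTemperateGrowth
  have hcomp : (fun y : ℝ => g (t + y • c)).HasTemperateGrowth := hg.comp haff
  -- With `t` fixed this is Stein's lemma in `y`: the `y`-derivative of `g (t + y • c)` is the
  -- derivative of `g` along `c`, and `v • c = d`.
  rw [integral_mul_gaussianReal hv hcomp, ← integral_const_mul]
  congr 1
  ext y
  have h1 : HasDerivAt (fun y : ℝ => t + y • c) c y := by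
    simpa using ((hasDerivAt_id y).smul_const c).const_add t
  have h2 := (hg.1.differentiable (by simp) (t + y • c)).hasFDerivAt.comp_hasDerivAt y h1
  rw [hdc, map_smul, Complex.real_smul]
  congr 1
  exact h2.deriv

end Stein


/-! ### Wirtinger derivatives in an arbitrary direction. -/

section DirWirtinger

variable {E E' : Type*} [NormedAddCommGroup E] [NormedSpace ℂ E]
  [NormedAddCommGroup E'] [NormedSpace ℂ E']

/-- The holomorphic part of the real derivative of `G` in the direction `a`. -/
def dirWirtinger (G : E → ℂ) (a x : E) : ℂ :=
  (fderiv ℝ G x a - Complex.I * fderiv ℝ G x (Complex.I • a)) / 2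

theorem dirWirtinger_mul {G₁ G₂ : E → ℂ} (a x : E) (h₁ : DifferentiableAt ℝ G₁ x)
    (h₂ : DifferentiableAt ℝ G₂ x) :
    dirWirtinger (fun y => G₁ y * G₂ y) a x
      = dirWirtinger G₁ a x * G₂ x + G₁ x * dirWirtinger G₂ a x := by
  unfold dirWirtinger
  rw [fderiv_fun_mul h₁ h₂]
  simp only [add_apply, smul_apply, smul_eq_mul]
  ring

theorem dirWirtinger_add {G₁ G₂ : E → ℂ} (a x : E) (h₁ : DifferentiableAt ℝ G₁ x)
    (h₂ : DifferentiableAt ℝ G₂ x) :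
    dirWirtinger (fun y => G₁ y + G₂ y) a x = dirWirtinger G₁ a x + dirWirtinger G₂ a x := by
  unfold dirWirtinger
  rw [fderiv_fun_add h₁ h₂]
  simp only [add_apply]
  ring

theorem dirWirtinger_const (c : ℂ) (a x : E) : dirWirtinger (fun _ => c) a x = 0 := by
  simp [dirWirtinger]

theorem dirWirtinger_comp_clm {g : E' → ℂ} (π : E →L[ℂ] E') (a x : E)
    (hg : DifferentiableAt ℝ g (π x)) :
    dirWirtinger (fun y => g (π y)) a x = dirWirtinger g (π a) (π x) := by
  have h := (hg.hasFDerivAt.comp x (π.restrictScalars ℝ).hasFDerivAt).fderiv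
  have h' : fderiv ℝ (fun y => g (π y)) x = (fderiv ℝ g (π x)).comp (π.restrictScalars ℝ) := h
  simp [dirWirtinger, h']

theorem hasTemperateGrowth_dirWirtinger {G : E → ℂ} (hG : G.HasTemperateGrowth) (a : E) :
    (dirWirtinger G a).HasTemperateGrowth := by
  have h1 := hasTemperateGrowth_fderiv_apply hG a
  have h2 := hasTemperateGrowth_fderiv_apply hG (Complex.I • a)
  have h3 := (h1.sub ((Function.HasTemperateGrowth.const Complex.I).mul h2)).mul
    (Function.HasTemperateGrowth.const (2 : ℂ)⁻¹)
  exact h3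

theorem wirtinger_eq_dirWirtinger {k : ℕ} (g : (Fin k → ℂ) → ℂ) (j : Fin k) (z : Fin k → ℂ) :
    wirtinger g j z = dirWirtinger g (Pi.single j 1) z := by
  unfold wirtinger dirWirtinger
  rw [← Pi.single_smul, smul_eq_mul, mul_one]

theorem dirWirtinger_add_dir (G : E → ℂ) (a b x : E) :
    dirWirtinger G (a + b) x = dirWirtinger G a x + dirWirtinger G b x := by
  simp only [dirWirtinger, smul_add, map_add]; ring

/-- For a real-linear `L`, the map `a ↦ (L a - i L (i a)) / 2` is the complex-linear part of `L`.
The conjugate-linear part is what the combination cancels. -/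
theorem dirWirtinger_smul_dir (G : E → ℂ) (c : ℂ) (a x : E) :
    dirWirtinger G (c • a) x = c * dirWirtinger G a x := by
  have h : ∀ (L : E →L[ℝ] ℂ) (b : E), L (c • b) = c.re * L b + c.im * L (Complex.I • b) := by
    intro L b
    have : c • b = c.re • b + c.im • (Complex.I • b) := by
      conv_lhs => rw [← Complex.re_add_im c, add_smul, mul_smul]
      simp
    rw [this, map_add, map_smul, map_smul, Complex.real_smul, Complex.real_smul]
  have hI : Complex.I • (Complex.I • a) = -a := by rw [smul_smul]; simp
  simp only [dirWirtinger]
  rw [smul_comm Complex.I c a, h, h _ (Complex.I • a), hI, map_neg]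
  conv_rhs => rw [← Complex.re_add_im c]
  linear_combination ((c.im : ℂ) * (fderiv ℝ G x (Complex.I • a)) / 2) * Complex.I_mul_I

theorem dirWirtinger_eq_sum {k : ℕ} (g : (Fin k → ℂ) → ℂ) (a z : Fin k → ℂ) :
    dirWirtinger g a z = ∑ j, wirtinger g j z * a j := by
  have h0 : dirWirtinger g 0 z = 0 := by simp [dirWirtinger]
  have h : ∀ s : Finset (Fin k), dirWirtinger g (∑ j ∈ s, a j • Pi.single j 1) z
      = ∑ j ∈ s, wirtinger g j z * a j := by
    intro s
    induction s using Finset.induction_on with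
    | empty => simpa using h0
    | insert i s hi ih =>
      rw [Finset.sum_insert hi, Finset.sum_insert hi, dirWirtinger_add_dir, ih,
        dirWirtinger_smul_dir, ← wirtinger_eq_dirWirtinger, mul_comm]
  rw [← h]
  congr 1
  ext i
  simp [Finset.sum_apply, Pi.single_apply]

end DirWirtinger

/-! ### Integration by parts for the complex isonormal process. -/

section IntegrationByParts

variable {H : Type*} [NormedAddCommGroup H] [InnerProductSpace ℂ H]
  {Ω : Type*} [MeasurableSpace Ω] {P : Measure Ω} {Z : H → Ω → ℂ}

theorem IsComplexIsonormal.memLp (hZ : IsComplexIsonormal Z P) (h : H) {p : ℝ≥0∞} (hp : p ≠ ∞) :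
    MemLp (Z h) p P :=
  (hZ.gaussian.hasGaussianLaw_eval h).memLp hp

theorem IsComplexIsonormal.integrable_mul (hZ : IsComplexIsonormal Z P) (g h : H) :
    Integrable (fun ω => Z g ω * Z h ω) P :=
  (hZ.memLp g (p := 2) (by simp)).integrable_mul (hZ.memLp h (p := 2) (by simp))

theorem IsComplexIsonormal.integrable_mul_conj (hZ : IsComplexIsonormal Z P) (g h : H) :
    Integrable (fun ω => Z g ω * starRingEnd ℂ (Z h ω)) P :=
  (hZ.memLp g (p := 2) (by simp)).integrable_mul (hZ.memLp h (p := 2) (by simp)).star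

theorem IsComplexIsonormal.inner_toLp (hZ : IsComplexIsonormal Z P) (g h : H) :
    inner ℂ ((hZ.memLp g (p := 2) (by simp)).toLp (Z g))
      ((hZ.memLp h (p := 2) (by simp)).toLp (Z h)) = inner ℂ g h := by
  rw [L2.inner_def, ← hZ.covariance]
  refine integral_congr_ae ?_
  filter_upwards [(hZ.memLp g (p := 2) (by simp)).coeFn_toLp,
    (hZ.memLp h (p := 2) (by simp)).coeFn_toLp] with ω h1 h2
  rw [h1, h2, RCLike.inner_apply]

/-- Additivity is not an axiom of the process: the covariance alone makes the `L²` norm of the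
defect `Z (g + h) - Z g - Z h` vanish. -/
theorem IsComplexIsonormal.map_add (hZ : IsComplexIsonormal Z P) (g h : H) :
    Z (g + h) =ᵐ[P] fun ω => Z g ω + Z h ω := by
  have key : (hZ.memLp (g + h) (p := 2) (by simp)).toLp (Z (g + h))
      = (hZ.memLp g (p := 2) (by simp)).toLp (Z g)
        + (hZ.memLp h (p := 2) (by simp)).toLp (Z h) := by
    rw [← sub_eq_zero, ← inner_self_eq_zero (𝕜 := ℂ)]
    simp only [inner_sub_left, inner_sub_right, inner_add_left, inner_add_right, hZ.inner_toLp]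
    ring
  rw [← MemLp.toLp_add, MemLp.toLp_eq_toLp_iff] at key
  exact key

/-- Polarization of `E[Z(h)²] = 0`, made possible by additivity. -/
theorem IsComplexIsonormal.integral_mul (hZ : IsComplexIsonormal Z P) (g h : H) :
    ∫ ω, Z g ω * Z h ω ∂P = 0 := by
  have i1 := hZ.integrable_mul g g
  have i2 := hZ.integrable_mul h h
  have i3 := hZ.integrable_mul g h
  have e : ∫ ω, Z (g + h) ω ^ 2 ∂P
      = ∫ ω, (Z g ω * Z g ω + Z h ω * Z h ω + 2 * (Z g ω * Z h ω)) ∂P := by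
    refine integral_congr_ae ?_
    filter_upwards [hZ.map_add g h] with ω hω
    rw [hω]; ring
  have s1 := hZ.sq g
  have s2 := hZ.sq h
  simp only [pow_two] at s1 s2
  have i12 : Integrable (fun ω => Z g ω * Z g ω + Z h ω * Z h ω) P := i1.add i2
  rw [integral_add i12 (i3.const_mul 2), integral_add i1 i2, integral_const_mul, s1, s2,
    hZ.sq] at e
  simpa using e.symm

/-- Gaussian integration by parts over a finite subfamily of the process. -/
theorem IsComplexIsonormal.integral_conj_mul_restrict (hZ : IsComplexIsonormal Z P)
    (I : Finset H) (h₀ : I) {G : (I → ℂ) → ℂ} (hG : G.HasTemperateGrowth) :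
    ∫ ω, starRingEnd ℂ (Z h₀ ω) * G (fun i => Z i ω) ∂P
      = ∫ ω, dirWirtinger G (fun i => inner ℂ (h₀ : H) (i : H)) (fun i => Z i ω) ∂P := by
  have hX := hZ.gaussian.hasGaussianLaw I
  have := hX.isProbabilityMeasure
  have hXm : AEMeasurable (fun ω (i : I) => Z i ω) P := hX.aemeasurable
  set μ := P.map (fun ω (i : I) => Z i ω) with hμ
  have : IsGaussian μ := hX.isGaussian_map
  set a : I → ℂ := fun i => inner ℂ (h₀ : H) (i : H) with ha
  have hstar : ∀ ω, starRingEnd ℂ (Z h₀ ω) = (Z h₀ ω).re - Complex.I * (Z h₀ ω).im := by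
    intro ω
    apply Complex.ext <;> simp
  have hmem : ∀ p : ℝ≥0∞, p ≠ ∞ → MemLp (fun ω (i : I) => Z i ω) p P := fun p hp => hX.memLp hp
  have hint : ∀ {g : (I → ℂ) → ℂ}, g.HasTemperateGrowth →
      Integrable (fun ω => g (fun i => Z i ω)) P := fun hg =>
    memLp_one_iff_integrable.1 (memLp_comp_of_hasTemperateGrowth hmem hg 1 (by simp))
  -- The real theorem, applied to the functional `R` of the coordinate `h₀`. Because `E[Z_i Z_{h₀}]
  -- = 0`, the covariance vector is `a / 2` for the real part and `i a / 2` for the imaginary part.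
  have main : ∀ (R : ℂ →L[ℝ] ℝ) (c : ℂ),
      (∀ i : I, ∫ ω, (R (Z h₀ ω) : ℂ) * Z i ω ∂P = c * a i) →
      ∫ ω, (R (Z h₀ ω) : ℂ) * G (fun i => Z i ω) ∂P
        = ∫ ω, fderiv ℝ G (fun i => Z i ω) (c • a) ∂P := by
    intro R c hc
    set L : StrongDual ℝ (I → ℂ) := R.comp (ContinuousLinearMap.proj h₀) with hLdef
    have hL : ∀ x, L x = R (x h₀) := fun _ => rfl
    have hL0 : ∫ x, L x ∂μ = 0 := by
      rw [hμ, integral_map hXm L.continuous.aestronglyMeasurable]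
      simp only [hL]
      rw [R.integral_comp_comm (memLp_one_iff_integrable.1 (hZ.memLp _ (by simp))),
        hZ.centered, map_zero]
    have hLy : Integrable (fun ω => R (Z h₀ ω) • (fun i : I => Z i ω)) P :=
      memLp_one_iff_integrable.1 ((hmem 2 (by simp)).smul (p := 2) (q := 2)
        (R.comp_memLp' (hZ.memLp h₀ (by simp))))
    have hd : ∫ y, L y • y ∂μ = c • a := by
      rw [hμ, integral_map hXm
        (by fun_prop : Continuous fun y => L y • y).aestronglyMeasurable]
      simp only [hL]
      ext i
      have := (ContinuousLinearMap.proj i : (I → ℂ) →L[ℝ] ℂ).integral_comp_comm hLy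
      simp only [ContinuousLinearMap.proj_apply, Pi.smul_apply, Complex.real_smul] at this
      rw [← this, hc i]; rfl
    have h := integral_dual_mul_of_isGaussian μ L hL0 hG
    rw [hd, hμ, integral_map hXm, integral_map hXm] at h
    · exact h
    · exact (hasTemperateGrowth_fderiv_apply hG _).1.continuous.aestronglyMeasurable
    · have := hG.1.continuous
      exact (by fun_prop : Continuous fun x => (L x : ℂ) * G x).aestronglyMeasurable
  have hre := main Complex.reCLM (1 / 2) fun i => by
    have : ∀ ω, ((Complex.reCLM (Z h₀ ω) : ℝ) : ℂ) * Z i ω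
        = (1 / 2) * (Z i ω * Z h₀ ω + Z i ω * starRingEnd ℂ (Z h₀ ω)) := by
      intro ω
      rw [Complex.reCLM_apply, Complex.re_eq_add_conj]; ring
    simp only [this]
    rw [integral_const_mul, integral_add (hZ.integrable_mul _ _) (hZ.integrable_mul_conj _ _),
      hZ.integral_mul, hZ.covariance, zero_add]
  have him := main Complex.imCLM (Complex.I / 2) fun i => by
    have : ∀ ω, ((Complex.imCLM (Z h₀ ω) : ℝ) : ℂ) * Z i ω
        = (Complex.I / 2) * (Z i ω * starRingEnd ℂ (Z h₀ ω) - Z i ω * Z h₀ ω) := by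
      intro ω
      rw [Complex.imCLM_apply, Complex.im_eq_sub_conj]
      field_simp
      rw [Complex.I_sq]; ring
    simp only [this]
    rw [integral_const_mul, integral_sub (hZ.integrable_mul_conj _ _) (hZ.integrable_mul _ _),
      hZ.integral_mul, hZ.covariance, sub_zero]
  have hproj : (fun x : I → ℂ => x h₀).HasTemperateGrowth :=
    (ContinuousLinearMap.proj h₀ : (I → ℂ) →L[ℝ] ℂ).hasTemperateGrowth
  have hR : ∀ R : ℂ →L[ℝ] ℝ, Integrable (fun ω => (R (Z h₀ ω) : ℂ) * G (fun i => Z i ω)) P :=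
    fun R => hint (((Complex.ofRealCLM.comp R).hasTemperateGrowth.comp hproj).mul hG)
  -- Since `conj Z = Re Z - i Im Z`, the derivatives along `a / 2` and `i a / 2` combine into
  -- exactly the Wirtinger derivative along `a`.
  calc ∫ ω, starRingEnd ℂ (Z h₀ ω) * G (fun i => Z i ω) ∂P
      = ∫ ω, (((Complex.reCLM (Z h₀ ω) : ℝ) : ℂ) * G (fun i => Z i ω)
          - Complex.I * (((Complex.imCLM (Z h₀ ω) : ℝ) : ℂ) * G (fun i => Z i ω))) ∂P := by
        congr 1; ext ω
        rw [hstar, Complex.reCLM_apply, Complex.imCLM_apply]; ring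
    _ = ∫ ω, fderiv ℝ G (fun i => Z i ω) ((1 / 2 : ℂ) • a) ∂P
          - Complex.I * ∫ ω, fderiv ℝ G (fun i => Z i ω) ((Complex.I / 2) • a) ∂P := by
        rw [integral_sub (hR _) ((hR _).const_mul _), integral_const_mul, hre, him]
    _ = ∫ ω, dirWirtinger G a (fun i => Z i ω) ∂P := by
        rw [← integral_const_mul, ← integral_sub
          (hint (hasTemperateGrowth_fderiv_apply hG _))
          ((hint (hasTemperateGrowth_fderiv_apply hG _)).const_mul _)]
        congr 1; ext ω
        have e1 : (1 / 2 : ℂ) • a = (1 / 2 : ℝ) • a := by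
          ext i; simp
        have e2 : (Complex.I / 2) • a = (1 / 2 : ℝ) • (Complex.I • a) := by
          ext i; simp; ring
        rw [e1, e2, map_smul, map_smul, dirWirtinger]
        simp only [Complex.real_smul]; push_cast; ring

/-- Gaussian integration by parts for a smooth function of finitely many `Z (h j)`. -/
theorem IsComplexIsonormal.integral_conj_mul (hZ : IsComplexIsonormal Z P)
    {κ : Type*} [Fintype κ] (h : κ → H) (h₀ : H) {G : (κ → ℂ) → ℂ} (hG : G.HasTemperateGrowth) :
    ∫ ω, starRingEnd ℂ (Z h₀ ω) * G (fun i => Z (h i) ω) ∂P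
      = ∫ ω, dirWirtinger G (fun i => inner ℂ h₀ (h i)) (fun i => Z (h i) ω) ∂P := by
  classical
  -- The family `h` may omit `h₀` or repeat vectors, so `G` is pulled back to a finite set
  -- containing `h₀` along a complex-linear projection.
  set I : Finset H := insert h₀ (Finset.univ.image h) with hI
  have hmem : ∀ j, h j ∈ I := fun j =>
    Finset.mem_insert_of_mem (Finset.mem_image_of_mem _ (Finset.mem_univ j))
  set π : (I → ℂ) →L[ℂ] (κ → ℂ) :=
    ContinuousLinearMap.pi fun j => ContinuousLinearMap.proj ⟨h j, hmem j⟩ with hπ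
  have hGπ : (fun x => G (π x)).HasTemperateGrowth :=
    hG.comp (π.restrictScalars ℝ).hasTemperateGrowth
  have key := hZ.integral_conj_mul_restrict I ⟨h₀, Finset.mem_insert_self _ _⟩ hGπ
  simp only [dirWirtinger_comp_clm π _ _ (hG.1.differentiable (by simp) _)] at key
  exact key

end IntegrationByParts

/-! ### Closability of the Malliavin derivative. -/

section Closability

variable {H : Type*} [NormedAddCommGroup H] [InnerProductSpace ℂ H]
  {Ω : Type*} [MeasurableSpace Ω] {P : Measure Ω} {Z : H → Ω → ℂ}

theorem IsComplexIsonormal.memLp_comp (hZ : IsComplexIsonormal Z P) {κ : Type*} [Fintype κ]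
    (h : κ → H) {g : (κ → ℂ) → ℂ} (hg : g.HasTemperateGrowth) {p : ℝ≥0∞} (hp : p ≠ ∞) :
    MemLp (fun ω => g fun i => Z (h i) ω) p P := by
  have := hZ.gaussian.isProbabilityMeasure
  exact memLp_comp_of_hasTemperateGrowth (fun p hp => MemLp.of_eval fun i => hZ.memLp (h i) hp)
    hg p hp

theorem memLp_smul_const {X : Ω → ℂ} {p : ℝ≥0∞} (hX : MemLp X p P) (v : H) :
    MemLp (fun ω => X ω • v) p P :=
  ((ContinuousLinearMap.id ℂ ℂ).smulRight v).comp_memLp' hX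

/-- Duality: `D` has a densely defined adjoint. -/
theorem IsComplexIsonormal.exists_adjoint (hZ : IsComplexIsonormal Z P) {k' : ℕ}
    (h' : Fin k' → H) {g' : (Fin k' → ℂ) → ℂ} (hg' : g'.HasTemperateGrowth) (h₀ : H) :
    ∃ K : Lp ℂ 2 P, ∀ q ∈ smoothGraph Z P,
      inner ℂ ((memLp_smul_const (hZ.memLp_comp h' hg' (p := 2) (by simp)) h₀).toLp) q.2
        = inner ℂ K q.1 := by
  set b : (Fin k' → ℂ) → ℂ := fun z => starRingEnd ℂ (g' z) with hb
  have hbg : b.HasTemperateGrowth :=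
    (Complex.conjCLE : ℂ →L[ℝ] ℂ).hasTemperateGrowth.comp hg'
  set a' : Fin k' → ℂ := fun i => inner ℂ h₀ (h' i) with ha'
  set X' : Ω → (Fin k' → ℂ) := fun ω i => Z (h' i) ω with hX'
  have hB : ∀ p : ℝ≥0∞, p ≠ ∞ → MemLp (fun ω => b (X' ω)) p P :=
    fun p hp => hZ.memLp_comp h' hbg hp
  have hB' : ∀ p : ℝ≥0∞, p ≠ ∞ → MemLp (fun ω => dirWirtinger b a' (X' ω)) p P :=
    fun p hp => hZ.memLp_comp h' (hasTemperateGrowth_dirWirtinger hbg a') hp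
  have hZ0 : ∀ p : ℝ≥0∞, p ≠ ∞ → MemLp (fun ω => starRingEnd ℂ (Z h₀ ω)) p P :=
    fun p hp => (hZ.memLp h₀ hp).star
  -- The conjugate of this variable is the divergence of `g' h₀`. It is what remains when
  -- integration by parts is applied to `g · conj g'` and the Leibniz term falling on `conj g'` is
  -- moved to the other side.
  have hK := ((memLp_mul_of_forall hZ0 hB 2 (by simp)).sub (hB' 2 (by simp)))
  refine ⟨hK.star.toLp, ?_⟩
  rintro ⟨F, u⟩ ⟨k, g, h, hg, hF, hu⟩
  simp only at hF hu ⊢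
  set a : Fin k → ℂ := fun i => inner ℂ h₀ (h i) with ha
  set X : Ω → (Fin k → ℂ) := fun ω i => Z (h i) ω with hX
  have hg1 : ∀ p : ℝ≥0∞, p ≠ ∞ → MemLp (fun ω => g (X ω)) p P :=
    fun p hp => hZ.memLp_comp h hg hp
  have hg2 : ∀ p : ℝ≥0∞, p ≠ ∞ → MemLp (fun ω => dirWirtinger g a (X ω)) p P :=
    fun p hp => hZ.memLp_comp h (hasTemperateGrowth_dirWirtinger hg a) hp
  set pl : ((Fin k ⊕ Fin k') → ℂ) →L[ℂ] (Fin k → ℂ) :=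
    ContinuousLinearMap.pi fun j => ContinuousLinearMap.proj (Sum.inl j) with hpl
  set pr : ((Fin k ⊕ Fin k') → ℂ) →L[ℂ] (Fin k' → ℂ) :=
    ContinuousLinearMap.pi fun j => ContinuousLinearMap.proj (Sum.inr j) with hpr
  have hgl : (fun z => g (pl z)).HasTemperateGrowth :=
    hg.comp (pl.restrictScalars ℝ).hasTemperateGrowth
  have hbr : (fun z => b (pr z)).HasTemperateGrowth :=
    hbg.comp (pr.restrictScalars ℝ).hasTemperateGrowth
  have key := hZ.integral_conj_mul (Sum.elim h h') h₀ (hgl.mul hbr)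
  have e1 : ∀ z, dirWirtinger ((fun z => g (pl z)) * fun z => b (pr z))
      (fun i => inner ℂ h₀ (Sum.elim h h' i)) z
      = dirWirtinger g a (pl z) * b (pr z) + g (pl z) * dirWirtinger b a' (pr z) := by
    intro z
    refine (dirWirtinger_mul _ _ (hgl.1.differentiable (by simp) _)
      (hbr.1.differentiable (by simp) _)).trans ?_
    rw [dirWirtinger_comp_clm pl _ _ (hg.1.differentiable (by simp) _),
      dirWirtinger_comp_clm pr _ _ (hbg.1.differentiable (by simp) _)]
    rfl
  simp only [e1] at key
  have hpl' : ∀ ω, pl (fun i => Z (Sum.elim h h' i) ω) = X ω := fun _ => rfl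
  have hpr' : ∀ ω, pr (fun i => Z (Sum.elim h h' i) ω) = X' ω := fun _ => rfl
  simp only [hpl', hpr', Pi.mul_apply] at key
  have i1 : Integrable (fun ω => dirWirtinger g a (X ω) * b (X' ω)) P :=
    memLp_one_iff_integrable.1 (memLp_mul_of_forall hg2 hB 1 (by simp))
  have i2 : Integrable (fun ω => g (X ω) * dirWirtinger b a' (X' ω)) P :=
    memLp_one_iff_integrable.1 (memLp_mul_of_forall hg1 hB' 1 (by simp))
  have i3 : Integrable (fun ω => starRingEnd ℂ (Z h₀ ω) * (g (X ω) * b (X' ω))) P :=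
    memLp_one_iff_integrable.1
      (memLp_mul_of_forall hZ0 (memLp_mul_of_forall hg1 hB) 1 (by simp))
  rw [integral_add i1 i2, ← sub_eq_iff_eq_add, ← integral_sub i3 i2] at key
  rw [L2.inner_def, L2.inner_def]
  calc _ = ∫ ω, dirWirtinger g a (X ω) * b (X' ω) ∂P := by
        refine integral_congr_ae ?_
        filter_upwards [hu, (memLp_smul_const (hZ.memLp_comp h' hg' (p := 2) (by simp))
          h₀).coeFn_toLp] with ω h1 h2
        rw [h1, h2, inner_smul_left, inner_sum, dirWirtinger_eq_sum, mul_comm]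
        congr 1
        exact Finset.sum_congr rfl fun j _ => inner_smul_right _ _ _
    _ = _ := by
        rw [← key]
        refine integral_congr_ae ?_
        filter_upwards [hF, hK.star.coeFn_toLp] with ω h1 h2
        rw [h1, h2, RCLike.inner_apply]
        simp only [Pi.star_apply, Pi.sub_apply, RCLike.star_def, Complex.conj_conj]
        ring

/-- The complex Malliavin derivative is closable. -/
theorem HasMalliavinDeriv.unique (hZ : IsComplexIsonormal Z P) {F : Lp ℂ 2 P} {u u' : Lp H 2 P}
    (hu : HasMalliavinDeriv Z P F u) (hu' : HasMalliavinDeriv Z P F u') : u = u' := by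
  -- Density of `S` in `L²(Ω; H)` is not needed, nor can it be expected on a general `Ω`. Both
  -- derivatives lie in the closure of `S` and their difference is orthogonal to `S`, so it is
  -- orthogonal to itself.
  set S : Submodule ℂ (Lp H 2 P) := Submodule.span ℂ
    {w | ∃ (k : ℕ) (h : Fin k → H) (g : (Fin k → ℂ) → ℂ) (hg : g.HasTemperateGrowth) (h₀ : H),
      w = (memLp_smul_const (hZ.memLp_comp h hg (p := 2) (by simp)) h₀).toLp} with hS
  have hmem : ∀ q ∈ smoothGraph Z P, q.2 ∈ S := by
    rintro ⟨F, u⟩ ⟨k, g, h, hg, hF, hu⟩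
    have hw : ∀ j, (wirtinger g j).HasTemperateGrowth := fun j => by
      rw [show wirtinger g j = dirWirtinger g (Pi.single j 1) from
        funext fun z => wirtinger_eq_dirWirtinger g j z]
      exact hasTemperateGrowth_dirWirtinger hg (Pi.single j 1)
    have : u = ∑ j, (memLp_smul_const (hZ.memLp_comp h (hw j) (p := 2) (by simp)) (h j)).toLp := by
      refine Lp.ext ?_
      refine Filter.EventuallyEq.trans hu ?_
      refine Filter.EventuallyEq.trans ?_ (Lp.coeFn_finsetSum _ _).symm
      have : ∀ᵐ ω ∂P, ∀ j : Fin k, (memLp_smul_const (hZ.memLp_comp h (hw j) (p := 2) (by simp))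
          (h j)).toLp _ ω = wirtinger g j (fun i => Z (h i) ω) • h j :=
        ae_all_iff.2 fun j => (memLp_smul_const (hZ.memLp_comp h (hw j) (p := 2) (by simp))
          (h j)).coeFn_toLp
      filter_upwards [this] with ω hω
      rw [Finset.sum_apply]
      exact Finset.sum_congr rfl fun j _ => (hω j).symm
    change u ∈ S
    rw [this]
    exact S.sum_mem fun j _ => Submodule.subset_span ⟨k, h, _, hw j, h j, rfl⟩
  have hcl : ∀ {u}, HasMalliavinDeriv Z P F u → u ∈ S.topologicalClosure := fun {u} hu =>
    closure_minimal (s := smoothGraph Z P)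
      (t := Prod.snd ⁻¹' (S.topologicalClosure : Set (Lp H 2 P)))
      (fun q hq => S.le_topologicalClosure (hmem q hq))
      (S.isClosed_topologicalClosure.preimage continuous_snd) hu
  have horth : u - u' ∈ Sᗮ := by
    rw [hS, Submodule.mem_orthogonal]
    intro w hw
    induction hw using Submodule.span_induction with
    | mem w hw =>
      obtain ⟨k, h, g, hg, h₀, rfl⟩ := hw
      obtain ⟨K, hK⟩ := hZ.exists_adjoint h hg h₀
      have hK' : ∀ q ∈ closure (smoothGraph Z P), inner ℂ
          ((memLp_smul_const (hZ.memLp_comp h hg (p := 2) (by simp)) h₀).toLp) q.2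
          = inner ℂ K q.1 := fun q hq =>
        closure_minimal (t := {q : Lp ℂ 2 P × Lp H 2 P | inner ℂ
          ((memLp_smul_const (hZ.memLp_comp h hg (p := 2) (by simp)) h₀).toLp) q.2
          = inner ℂ K q.1}) hK (isClosed_eq (by fun_prop) (by fun_prop)) hq
      rw [inner_sub_right, hK' _ hu, hK' _ hu', sub_self]
    | zero => simp
    | add x y _ _ hx hy => rw [inner_add_left, hx, hy, add_zero]
    | smul c x _ hx => rw [inner_smul_left, hx, mul_zero]
  rw [← Submodule.orthogonal_closure] at horth
  rw [← sub_eq_zero]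
  have := Submodule.inner_right_of_mem_orthogonal
    (S.topologicalClosure.sub_mem (hcl hu) (hcl hu')) horth
  exact inner_self_eq_zero.1 this

end Closability


/-! ### Complex Hermite polynomials and the number operator, algebraically. -/

section Polynomials

variable {ι : Type*}

variable (ι) in
/-- Polynomials in variables `z_i` (`Sum.inl i`) and their conjugates (`Sum.inr i`). -/
abbrev ConjPoly := MvPolynomial (ι ⊕ ι) ℂ

/-- Complex conjugation of polynomials. -/
def polyBar : ConjPoly ι →+* ConjPoly ι :=
  (MvPolynomial.rename (R := ℂ) Sum.swap).toRingHom.comp (MvPolynomial.map (starRingEnd ℂ))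

/-- `∂/∂z_i`. -/
def dz (i : ι) : Derivation ℂ (ConjPoly ι) (ConjPoly ι) := MvPolynomial.pderiv (Sum.inl i)

/-- The derivative with respect to the conjugate variable of index `i`. -/
def dzbar (i : ι) : Derivation ℂ (ConjPoly ι) (ConjPoly ι) := MvPolynomial.pderiv (Sum.inr i)

@[simp] theorem polyBar_C (c : ℂ) :
    polyBar (MvPolynomial.C c : ConjPoly ι) = MvPolynomial.C (starRingEnd ℂ c) := by
  simp [polyBar]

@[simp] theorem polyBar_inl (i : ι) :
    polyBar (MvPolynomial.X (Sum.inl i) : ConjPoly ι) = MvPolynomial.X (Sum.inr i) := by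
  simp [polyBar]

@[simp] theorem polyBar_inr (i : ι) :
    polyBar (MvPolynomial.X (Sum.inr i) : ConjPoly ι) = MvPolynomial.X (Sum.inl i) := by
  simp [polyBar]

theorem polyBar_smul (c : ℂ) (p : ConjPoly ι) :
    polyBar (c • p) = starRingEnd ℂ c • polyBar p := by
  rw [MvPolynomial.smul_eq_C_mul, map_mul, polyBar_C, ← MvPolynomial.smul_eq_C_mul]

@[simp] theorem polyBar_polyBar (p : ConjPoly ι) : polyBar (polyBar p) = p := by
  induction p using MvPolynomial.induction_on with
  | C a => simp
  | add p q hp hq => simp [hp, hq]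
  | mul_X p i hp => cases i <;> simp [hp]

theorem dz_polyBar (i : ι) (p : ConjPoly ι) : dz i (polyBar p) = polyBar (dzbar i p) := by
  change MvPolynomial.pderiv (Sum.swap (Sum.inr i)) (MvPolynomial.rename Sum.swap _) =
    MvPolynomial.rename Sum.swap (MvPolynomial.map (starRingEnd ℂ) _)
  rw [MvPolynomial.pderiv_rename (Sum.swap_leftInverse.injective), MvPolynomial.pderiv_map]
  rfl

open Classical in
/-- The indices of the variables of a polynomial. -/
def polySupp (p : ConjPoly ι) : Finset ι := p.vars.image (Sum.elim id id)

theorem dz_eq_zero {p : ConjPoly ι} {i : ι} (hi : i ∉ polySupp p) : dz i p = 0 := by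
  classical
  exact MvPolynomial.pderiv_eq_zero_of_notMem_vars fun h =>
    hi (Finset.mem_image.2 ⟨Sum.inl i, h, rfl⟩)

theorem polySupp_sub_subset [DecidableEq ι] (p q : ConjPoly ι) :
    polySupp (p - q) ⊆ polySupp p ∪ polySupp q := by
  classical
  intro i hi
  simp only [polySupp, Finset.mem_image, Finset.mem_union] at hi ⊢
  obtain ⟨x, hx, rfl⟩ := hi
  rcases Finset.mem_union.1 (MvPolynomial.vars_sub_subset p hx) with h | h
  · exact Or.inl ⟨x, h, rfl⟩
  · exact Or.inr ⟨x, h, rfl⟩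

/-- The complex Hermite polynomial `J_{a,b}(z_i, 1)`. -/
def hermitePoly (i : ι) : ℕ → ℕ → ConjPoly ι
  | 0, b => MvPolynomial.X (Sum.inr i) ^ b
  -- At `b = 0` the truncated `b - 1` is harmless because the factor `b` vanishes.
  | a + 1, b => MvPolynomial.X (Sum.inl i) * hermitePoly i a b
      - (b : ConjPoly ι) * hermitePoly i a (b - 1)

theorem hermitePoly_succ_left (i : ι) (a b : ℕ) : hermitePoly i (a + 1) b =
    MvPolynomial.X (Sum.inl i) * hermitePoly i a b
      - (b : ConjPoly ι) * hermitePoly i a (b - 1) := rfl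

/-- The definition recurses on the first index only. This mirror recursion is what makes conjugation
swap the two indices. -/
theorem hermitePoly_succ_right (i : ι) (a b : ℕ) : hermitePoly i a (b + 1) =
    MvPolynomial.X (Sum.inr i) * hermitePoly i a b
      - (a : ConjPoly ι) * hermitePoly i (a - 1) b := by
  induction a generalizing b with
  | zero => simp [hermitePoly, pow_succ']
  | succ a ih =>
    rw [hermitePoly_succ_left, hermitePoly_succ_left, ih b, Nat.add_sub_cancel,
      Nat.add_sub_cancel]
    rcases a with _ | a
    · rcases b with _ | b
      · simp [hermitePoly]; ring
      · simp [hermitePoly]; ring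
    · have h2 := hermitePoly_succ_left i a b
      rw [Nat.add_sub_cancel]
      rcases b with _ | b
      · simp only [Nat.cast_zero, zero_mul, sub_zero] at h2 ⊢
        push_cast
        rw [h2]; ring
      · have h1 := ih b
        rw [Nat.add_sub_cancel] at h1 h2 ⊢
        push_cast at h1 h2 ⊢
        linear_combination ((a : ConjPoly ι) + 1) * h2 - ((b : ConjPoly ι) + 1) * h1

theorem polyBar_hermitePoly (i : ι) (a b : ℕ) :
    polyBar (hermitePoly i a b) = hermitePoly i b a := by
  induction a generalizing b with
  | zero =>
    induction b with
    | zero => simp [hermitePoly]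
    | succ b ih => rw [hermitePoly_succ_left, ← ih]; simp [hermitePoly, pow_succ']
  | succ a ih =>
    rw [hermitePoly_succ_left, hermitePoly_succ_right, map_sub, map_mul, map_mul, ih, ih,
      polyBar_inl, map_natCast]

theorem dzbar_hermitePoly (i : ι) (a b : ℕ) :
    dzbar i (hermitePoly i a b) = (b : ConjPoly ι) * hermitePoly i a (b - 1) := by
  induction a generalizing b with
  | zero => simp [hermitePoly, dzbar, Derivation.leibniz_pow]
  | succ a ih =>
    have hX : dzbar i (MvPolynomial.X (Sum.inl i)) = 0 := by
      simp [dzbar]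
    rw [hermitePoly_succ_left, map_sub, Derivation.leibniz, Derivation.leibniz, ih, ih, hX,
      hermitePoly_succ_left, Derivation.map_natCast]
    rcases b with _ | b
    · simp
    · simp only [Nat.add_sub_cancel, smul_eq_mul, mul_zero, add_zero]
      push_cast; ring

theorem dz_hermitePoly (i : ι) (a b : ℕ) :
    dz i (hermitePoly i a b) = (a : ConjPoly ι) * hermitePoly i (a - 1) b := by
  rw [← polyBar_hermitePoly, dz_polyBar, dzbar_hermitePoly, map_mul, map_natCast,
    polyBar_hermitePoly]

theorem dz_hermitePoly_of_ne {i j : ι} (h : i ≠ j) (a b : ℕ) : dz i (hermitePoly j a b) = 0 := by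
  induction a generalizing b with
  | zero => simp [hermitePoly, dz, Derivation.leibniz_pow]
  | succ a ih =>
    have hX : dz i (MvPolynomial.X (Sum.inl j)) = 0 := by
      simp [dz, MvPolynomial.pderiv_X_of_ne, h.symm]
    rw [hermitePoly_succ_left, map_sub, Derivation.leibniz, Derivation.leibniz, ih, ih, hX,
      Derivation.map_natCast]
    simp

theorem dzbar_hermitePoly_of_ne {i j : ι} (h : i ≠ j) (a b : ℕ) :
    dzbar i (hermitePoly j a b) = 0 := by
  have := dz_polyBar i (hermitePoly j a b)
  rw [polyBar_hermitePoly, dz_hermitePoly_of_ne h] at this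
  rw [← polyBar_polyBar (dzbar i _), ← this, map_zero]

/-- The one-variable number operator. -/
theorem number_hermitePoly (i : ι) (a b : ℕ) :
    MvPolynomial.X (Sum.inl i) * dz i (hermitePoly i a b) - dzbar i (dz i (hermitePoly i a b))
      = (a : ConjPoly ι) * hermitePoly i a b := by
  rcases a with _ | a
  · simp [dz_hermitePoly]
  · rw [dz_hermitePoly, Derivation.leibniz, Nat.add_sub_cancel, dzbar_hermitePoly,
      Derivation.map_natCast, hermitePoly_succ_left]
    simp only [smul_eq_mul, mul_zero, add_zero]
    ring

theorem derivation_prod_eq_zero (D : Derivation ℂ (ConjPoly ι) (ConjPoly ι)) (s : Finset ι)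
    (f : ι → ConjPoly ι) (h : ∀ j ∈ s, D (f j) = 0) : D (∏ j ∈ s, f j) = 0 := by
  classical
  induction s using Finset.induction_on with
  | empty => simp
  | insert i s hi ih =>
    rw [Finset.prod_insert hi, Derivation.leibniz, h i (Finset.mem_insert_self _ _),
      ih fun j hj => h j (Finset.mem_insert_of_mem hj)]
    simp

open Classical in
/-- The product `∏_k J_{a_k,b_k}(z_k, 1)`. -/
def multiHermite (a b : ι →₀ ℕ) : ConjPoly ι :=
  ∏ k ∈ a.support ∪ b.support, hermitePoly k (a k) (b k)

theorem multiHermite_eq_prod {a b : ι →₀ ℕ} {s : Finset ι} (ha : a.support ⊆ s)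
    (hb : b.support ⊆ s) : multiHermite a b = ∏ k ∈ s, hermitePoly k (a k) (b k) := by
  classical
  refine Finset.prod_subset (Finset.union_subset ha hb) fun k _ hk => ?_
  simp only [Finset.mem_union, Finsupp.mem_support_iff, not_or, not_not] at hk
  simp [hk.1, hk.2, hermitePoly]

theorem polyBar_multiHermite (a b : ι →₀ ℕ) :
    polyBar (multiHermite a b) = multiHermite b a := by
  classical
  simp only [multiHermite, map_prod, polyBar_hermitePoly]
  rw [Finset.union_comm]

/-- Splits off the factor with index `i`. The cofactor `R` is constant in `z_i` and its conjugate
and is unchanged when `a i` is lowered, so one-variable identities lift to products. -/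
theorem exists_multiHermite_eq (i : ι) (a b : ι →₀ ℕ) : ∃ R : ConjPoly ι,
    dz i R = 0 ∧ dzbar i R = 0 ∧ multiHermite a b = hermitePoly i (a i) (b i) * R ∧
    multiHermite (a - Finsupp.single i 1) b = hermitePoly i (a i - 1) (b i) * R := by
  classical
  set s := insert i (a.support ∪ b.support) with hs
  have ha : a.support ⊆ s := Finset.subset_union_left.trans (Finset.subset_insert _ _)
  have hb : b.support ⊆ s := Finset.subset_union_right.trans (Finset.subset_insert _ _)
  have ha' : (a - Finsupp.single i 1).support ⊆ s := (Finsupp.support_tsub).trans ha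
  have hi : i ∈ s := Finset.mem_insert_self _ _
  refine ⟨∏ k ∈ s.erase i, hermitePoly k (a k) (b k), ?_, ?_, ?_, ?_⟩
  · exact derivation_prod_eq_zero _ _ _ fun j hj =>
      dz_hermitePoly_of_ne (Finset.ne_of_mem_erase hj).symm _ _
  · exact derivation_prod_eq_zero _ _ _ fun j hj =>
      dzbar_hermitePoly_of_ne (Finset.ne_of_mem_erase hj).symm _ _
  · rw [multiHermite_eq_prod ha hb, Finset.mul_prod_erase s (fun k => hermitePoly k (a k) (b k)) hi]
  · rw [multiHermite_eq_prod ha' hb, ← Finset.mul_prod_erase s _ hi]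
    congr 1
    · simp
    · refine Finset.prod_congr rfl fun j hj => ?_
      simp [(Finset.ne_of_mem_erase hj).symm]

variable (ι) in
/-- The polynomials of the `(m, n)`-th Wiener chaos. -/
def chaos (m n : ℕ) : Submodule ℂ (ConjPoly ι) :=
  Submodule.span ℂ {p | ∃ a b : ι →₀ ℕ, a.degree = m ∧ b.degree = n ∧ p = multiHermite a b}

theorem polyBar_mem_chaos {m n : ℕ} {p : ConjPoly ι} (hp : p ∈ chaos ι m n) :
    polyBar p ∈ chaos ι n m := by
  induction hp using Submodule.span_induction with
  | mem p hp =>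
    obtain ⟨a, b, ha, hb, rfl⟩ := hp
    exact Submodule.subset_span ⟨b, a, hb, ha, polyBar_multiHermite a b⟩
  | zero => simp
  | add p q _ _ hp hq => rw [map_add]; exact add_mem hp hq
  | smul c p _ hp => rw [polyBar_smul]; exact Submodule.smul_mem _ _ hp

theorem dz_multiHermite (i : ι) (a b : ι →₀ ℕ) :
    dz i (multiHermite a b) = (a i : ℂ) • multiHermite (a - Finsupp.single i 1) b := by
  obtain ⟨R, h1, -, h3, h4⟩ := exists_multiHermite_eq i a b
  rw [h3, h4, Derivation.leibniz, h1, dz_hermitePoly, MvPolynomial.smul_eq_C_mul]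
  simp only [smul_eq_mul, mul_zero, zero_add, map_natCast]
  ring

/-- Each `∂_i` lowers one first index. For `m = 0` the truncated `m - 1` does no harm, since the
derivative is then zero. -/
theorem dz_mem_chaos {m n : ℕ} {p : ConjPoly ι} (hp : p ∈ chaos ι m n) (i : ι) :
    dz i p ∈ chaos ι (m - 1) n := by
  induction hp using Submodule.span_induction with
  | mem p hp =>
    obtain ⟨a, b, ha, hb, rfl⟩ := hp
    rw [dz_multiHermite]
    by_cases h : a i = 0
    · simp [h]
    · have hle : Finsupp.single i 1 ≤ a := by
        simpa [Finsupp.single_le_iff] using Nat.one_le_iff_ne_zero.2 h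
      have hdeg : (a - Finsupp.single i 1).degree + 1 = m := by
        rw [← ha]
        conv_rhs => rw [← tsub_add_cancel_of_le hle]
        simp
      exact Submodule.smul_mem _ _ (Submodule.subset_span ⟨_, b, by omega, hb, rfl⟩)
  | zero => simp
  | add p q _ _ hp hq => rw [map_add]; exact add_mem hp hq
  | smul c p _ hp => rw [Derivation.map_smul]; exact Submodule.smul_mem _ _ hp

theorem dz_chaos_zero {n : ℕ} {p : ConjPoly ι} (hp : p ∈ chaos ι 0 n) (i : ι) : dz i p = 0 := by
  induction hp using Submodule.span_induction with
  | mem p hp =>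
    obtain ⟨a, b, ha, hb, rfl⟩ := hp
    rw [dz_multiHermite, (Finsupp.degree_eq_zero_iff a).1 ha]
    simp
  | zero => simp
  | add p q _ _ hp hq => rw [map_add, hp, hq, add_zero]
  | smul c p _ hp => rw [Derivation.map_smul, hp, smul_zero]

theorem exists_C_of_mem_chaos_zero {p : ConjPoly ι} (hp : p ∈ chaos ι 0 0) :
    ∃ c, p = MvPolynomial.C c := by
  induction hp using Submodule.span_induction with
  | mem p hp =>
    obtain ⟨a, b, ha, hb, rfl⟩ := hp
    rw [(Finsupp.degree_eq_zero_iff a).1 ha, (Finsupp.degree_eq_zero_iff b).1 hb]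
    exact ⟨1, by simp [multiHermite]⟩
  | zero => exact ⟨0, by simp⟩
  | add p q _ _ hp hq =>
    obtain ⟨c, rfl⟩ := hp
    obtain ⟨d, rfl⟩ := hq
    exact ⟨c + d, by simp⟩
  | smul c p _ hp =>
    obtain ⟨d, rfl⟩ := hp
    exact ⟨c * d, by simp [MvPolynomial.smul_eq_C_mul]⟩

theorem number_multiHermite (i : ι) (a b : ι →₀ ℕ) :
    MvPolynomial.X (Sum.inl i) * dz i (multiHermite a b) - dzbar i (dz i (multiHermite a b))
      = (a i : ConjPoly ι) * multiHermite a b := by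
  obtain ⟨R, h1, h2, h3, -⟩ := exists_multiHermite_eq i a b
  have h := number_hermitePoly i (a i) (b i)
  have h5 : dz i (multiHermite a b) = dz i (hermitePoly i (a i) (b i)) * R := by
    rw [h3, Derivation.leibniz, h1]; simp [mul_comm]
  rw [h5, Derivation.leibniz, h2, h3]
  simp only [smul_eq_mul, mul_zero, zero_add]
  linear_combination R * h

/-- The number operator acts on the `(m, n)`-th chaos as multiplication by `m`. -/
theorem number_of_mem_chaos {m n : ℕ} {p : ConjPoly ι} (hp : p ∈ chaos ι m n) {s : Finset ι}
    (hs : polySupp p ⊆ s) :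
    ∑ i ∈ s, (MvPolynomial.X (Sum.inl i) * dz i p - dzbar i (dz i p)) = (m : ℂ) • p := by
  classical
  -- The inclusion `polySupp p ⊆ s` is not inherited by the summands of `p`, so the span induction
  -- proves the identity for all sufficiently large `s`. Terms outside `polySupp p` vanish, which
  -- brings the sum back to the given `s`.
  obtain ⟨s₀, h₀⟩ : ∃ s₀ : Finset ι, ∀ s, s₀ ⊆ s →
      ∑ i ∈ s, (MvPolynomial.X (Sum.inl i) * dz i p - dzbar i (dz i p)) = (m : ℂ) • p := by
    clear hs
    induction hp using Submodule.span_induction with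
    | mem p hp =>
      obtain ⟨a, b, ha, hb, rfl⟩ := hp
      refine ⟨a.support, fun s hs => ?_⟩
      simp only [number_multiHermite]
      rw [← Finset.sum_mul, MvPolynomial.smul_eq_C_mul, map_natCast, ← ha, Finsupp.degree_apply,
        ← Nat.cast_sum, Finset.sum_subset hs]
      intro i _ hi
      simpa using hi
    | zero => exact ⟨∅, by simp⟩
    | add p q _ _ hp hq =>
      obtain ⟨s₁, h₁⟩ := hp
      obtain ⟨s₂, h₂⟩ := hq
      refine ⟨s₁ ∪ s₂, fun s hs => ?_⟩
      rw [smul_add, ← h₁ s (Finset.union_subset_left hs), ← h₂ s (Finset.union_subset_right hs),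
        ← Finset.sum_add_distrib]
      refine Finset.sum_congr rfl fun i _ => ?_
      simp only [map_add]; ring
    | smul c p _ hp =>
      obtain ⟨s₁, h₁⟩ := hp
      refine ⟨s₁, fun s hs => ?_⟩
      rw [smul_comm, ← h₁ s hs, Finset.smul_sum]
      refine Finset.sum_congr rfl fun i _ => ?_
      simp only [Derivation.map_smul, mul_smul_comm, smul_sub]
  rw [← h₀ (s ∪ s₀) Finset.subset_union_right]
  refine Finset.sum_subset Finset.subset_union_left fun i _ hi => ?_
  rw [dz_eq_zero fun h => hi (hs h)]
  simp

end Polynomials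


/-! ### Evaluating polynomials; formal versus analytic derivatives. -/

section Evaluation

variable {ι κ : Type*}

/-- Evaluation of a polynomial in `z` and its conjugate. -/
def polyEval (z : ι → ℂ) : ConjPoly ι →ₐ[ℂ] ℂ :=
  MvPolynomial.aeval (Sum.elim z fun i => starRingEnd ℂ (z i))

@[simp] theorem polyEval_C (z : ι → ℂ) (c : ℂ) : polyEval z (MvPolynomial.C c) = c := by
  simp [polyEval]

@[simp] theorem polyEval_inl (z : ι → ℂ) (i : ι) :
    polyEval z (MvPolynomial.X (Sum.inl i)) = z i := by
  simp [polyEval]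

@[simp] theorem polyEval_inr (z : ι → ℂ) (i : ι) :
    polyEval z (MvPolynomial.X (Sum.inr i)) = starRingEnd ℂ (z i) := by
  simp [polyEval]

@[simp] theorem polyEval_polyBar (z : ι → ℂ) (p : ConjPoly ι) :
    polyEval z (polyBar p) = starRingEnd ℂ (polyEval z p) := by
  induction p using MvPolynomial.induction_on with
  | C a => simp
  | add p q hp hq => simp [hp, hq]
  | mul_X p i hp => cases i <;> simp [hp]

theorem polyEval_rename (z : ι → ℂ) (f : κ → ι) (q : ConjPoly κ) :
    polyEval z (MvPolynomial.rename (Sum.map f f) q) = polyEval (fun j => z (f j)) q := by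
  rw [polyEval, MvPolynomial.aeval_rename, polyEval]
  congr 2
  ext x
  cases x <;> rfl

theorem hasTemperateGrowth_polyEval [Fintype κ] (q : ConjPoly κ) :
    (fun z : κ → ℂ => polyEval z q).HasTemperateGrowth := by
  induction q using MvPolynomial.induction_on with
  | C a => simp
  | add p q hp hq => simpa using! hp.add hq
  | mul_X p i hp =>
    have h1 : ∀ i : κ, (fun z : κ → ℂ => z i).HasTemperateGrowth := fun i =>
      (ContinuousLinearMap.proj i : (κ → ℂ) →L[ℝ] ℂ).hasTemperateGrowth
    cases i with
    | inl i => simpa using! hp.mul (h1 i)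
    | inr i =>
      have h2 : (fun z : κ → ℂ => starRingEnd ℂ (z i)).HasTemperateGrowth :=
        (Complex.conjCLE : ℂ →L[ℝ] ℂ).hasTemperateGrowth.comp (h1 i)
      simpa using! hp.mul h2

/-- Both sides satisfy the Leibniz rule, so it suffices to check the variables; the conjugate
variables are annihilated by the holomorphic part. -/
theorem wirtinger_polyEval {k : ℕ} (q : ConjPoly (Fin k)) (j : Fin k) (z : Fin k → ℂ) :
    wirtinger (fun z => polyEval z q) j z = polyEval z (dz j q) := by
  rw [wirtinger_eq_dirWirtinger]
  have hd : ∀ p : ConjPoly (Fin k), DifferentiableAt ℝ (fun z : Fin k → ℂ => polyEval z p) z :=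
    fun p => (hasTemperateGrowth_polyEval p).1.differentiable (by simp) z
  induction q using MvPolynomial.induction_on with
  | C a => simp [dirWirtinger_const, dz]
  | add p q hp hq =>
    simp only [map_add, ← hp, ← hq]
    exact dirWirtinger_add _ _ (hd p) (hd q)
  | mul_X p x hp =>
    have hX : dirWirtinger (fun z => polyEval z (MvPolynomial.X x)) (Pi.single j 1) z
        = polyEval z (dz j (MvPolynomial.X x)) := by
      have hf : ∀ (i : Fin k) (v : Fin k → ℂ),
          fderiv ℝ (fun z : Fin k → ℂ => z i) z v = v i := fun i v => by
        have h2 : fderiv ℝ (fun z : Fin k → ℂ => z i) z = _ :=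
          (ContinuousLinearMap.proj i : (Fin k → ℂ) →L[ℝ] ℂ).hasFDerivAt.fderiv
        rw [h2]; rfl
      have hf' : ∀ (i : Fin k) (v : Fin k → ℂ),
          fderiv ℝ (fun z : Fin k → ℂ => starRingEnd ℂ (z i)) z v = starRingEnd ℂ (v i) :=
        fun i v => by
        have := ((Complex.conjCLE : ℂ →L[ℝ] ℂ).comp
          (ContinuousLinearMap.proj i : (Fin k → ℂ) →L[ℝ] ℂ)).hasFDerivAt (x := z)
        have h2 : fderiv ℝ (fun z : Fin k → ℂ => starRingEnd ℂ (z i)) z = _ := this.fderiv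
        rw [h2]; rfl
      cases x with
      | inl i =>
        simp only [polyEval_inl, dirWirtinger, hf]
        by_cases hij : i = j
        · subst hij
          simp only [Pi.single_eq_same, Pi.smul_apply, smul_eq_mul, mul_one, Complex.I_mul_I]
          simp [dz]
        · simp [hij, dz]
      | inr i =>
        simp only [polyEval_inr, dirWirtinger, hf']
        by_cases hij : i = j
        · subst hij
          simp only [Pi.single_eq_same, Pi.smul_apply, smul_eq_mul, mul_one, Complex.conj_I,
            map_one, mul_neg, Complex.I_mul_I]
          simp [dz]
        · simp [hij, dz]
    simp only [map_mul, Derivation.leibniz, map_add, smul_eq_mul, ← hp, ← hX]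
    rw [dirWirtinger_mul _ _ (hd p) (hd _)]
    ring

/-- The enumeration of a finite set of indices. -/
def finEnum (s : Finset ι) (j : Fin s.card) : ι := (s.equivFin.symm j : ι)

theorem finEnum_injective (s : Finset ι) : Function.Injective (finEnum s) :=
  Subtype.val_injective.comp s.equivFin.symm.injective

theorem sum_finEnum {M : Type*} [AddCommMonoid M] (s : Finset ι) (F : ι → M) :
    ∑ j, F (finEnum s j) = ∑ i ∈ s, F i := by
  rw [← Finset.sum_coe_sort s F]
  exact Equiv.sum_comp s.equivFin.symm (fun i : s => F i)

/-- Smooth random variables are functions on `Fin k → ℂ`, whereas polynomials have variables indexed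
by `ι`; this is the passage between the two. -/
theorem exists_rename_eq {p : ConjPoly ι} {s : Finset ι} (hs : polySupp p ⊆ s) :
    ∃ q : ConjPoly (Fin s.card),
      MvPolynomial.rename (Sum.map (finEnum s) (finEnum s)) q = p := by
  classical
  refine MvPolynomial.exists_rename_eq_of_vars_subset_range p _
    (Sum.map_injective.2 ⟨finEnum_injective s, finEnum_injective s⟩) ?_
  intro x hx
  have hr : ∀ i ∈ s, ∃ j, finEnum s j = i := fun i hi =>
    ⟨s.equivFin ⟨i, hi⟩, by simp [finEnum]⟩
  have hx' : Sum.elim id id x ∈ s := hs (Finset.mem_image_of_mem _ hx)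
  obtain ⟨j, hj⟩ := hr _ hx'
  cases x with
  | inl i => exact ⟨Sum.inl j, by simpa using hj⟩
  | inr i => exact ⟨Sum.inr j, by simpa using hj⟩

theorem dz_rename (f : κ → ι) (hf : Function.Injective f) (q : ConjPoly κ) (j : κ) :
    dz (f j) (MvPolynomial.rename (Sum.map f f) q)
      = MvPolynomial.rename (Sum.map f f) (dz j q) := by
  have := MvPolynomial.pderiv_rename (R := ℂ) (Sum.map_injective.2 ⟨hf, hf⟩) (Sum.inl j) q
  exact this

end Evaluation

/-! ### Polynomial random variables and the adjoint of differentiation. -/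

section RandomVariables

set_option linter.unusedSectionVars false

variable {ι : Type*} {H : Type*} [NormedAddCommGroup H] [InnerProductSpace ℂ H]
  {Ω : Type*} [MeasurableSpace Ω] {P : Measure Ω} {Z : H → Ω → ℂ} {e : ι → H}

/-- The random variable obtained by evaluating a polynomial at the `Z (e i)`. -/
def polyVar (Z : H → Ω → ℂ) (e : ι → H) (p : ConjPoly ι) (ω : Ω) : ℂ :=
  polyEval (fun i => Z (e i) ω) p

/-- The Malliavin derivative of `polyVar Z e p`. -/
def polyGrad (Z : H → Ω → ℂ) (e : ι → H) (p : ConjPoly ι) (ω : Ω) : H :=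
  ∑ i ∈ polySupp p, polyVar Z e (dz i p) ω • e i

theorem polyGrad_eq_sum {p : ConjPoly ι} {s : Finset ι} (hs : polySupp p ⊆ s) (ω : Ω) :
    polyGrad Z e p ω = ∑ i ∈ s, polyVar Z e (dz i p) ω • e i := by
  refine Finset.sum_subset hs fun i _ hi => ?_
  rw [dz_eq_zero hi]
  simp [polyVar]

theorem polyVar_sub (p q : ConjPoly ι) :
    polyVar Z e (p - q) = polyVar Z e p - polyVar Z e q := by
  ext ω; simp [polyVar]

theorem polyGrad_sub (p q : ConjPoly ι) :
    polyGrad Z e (p - q) = polyGrad Z e p - polyGrad Z e q := by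
  classical
  ext ω
  rw [Pi.sub_apply, polyGrad_eq_sum (polySupp_sub_subset p q),
    polyGrad_eq_sum (Finset.subset_union_left (s₂ := polySupp q)),
    polyGrad_eq_sum (Finset.subset_union_right (s₁ := polySupp p)), ← Finset.sum_sub_distrib]
  refine Finset.sum_congr rfl fun i _ => ?_
  rw [map_sub, polyVar_sub, Pi.sub_apply, sub_smul]

theorem exists_polyVar_eq {p : ConjPoly ι} {s : Finset ι} (hs : polySupp p ⊆ s) :
    ∃ q : ConjPoly (Fin s.card),
      (∀ ω, polyVar Z e p ω = polyEval (fun j => Z (e (finEnum s j)) ω) q) ∧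
      ∀ j ω, polyVar Z e (dz (finEnum s j) p) ω
        = wirtinger (fun z => polyEval z q) j (fun j => Z (e (finEnum s j)) ω) := by
  obtain ⟨q, rfl⟩ := exists_rename_eq hs
  refine ⟨q, fun ω => polyEval_rename _ _ _, fun j ω => ?_⟩
  rw [wirtinger_polyEval, dz_rename _ (finEnum_injective s)]
  exact polyEval_rename _ _ _

theorem memLp_polyVar (hZ : IsComplexIsonormal Z P) (e : ι → H) (p : ConjPoly ι) {r : ℝ≥0∞}
    (hr : r ≠ ∞) : MemLp (polyVar Z e p) r P := by
  obtain ⟨q, hq, -⟩ := exists_polyVar_eq (Z := Z) (e := e) (Finset.Subset.refl (polySupp p))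
  rw [funext hq]
  exact hZ.memLp_comp _ (hasTemperateGrowth_polyEval q) hr

theorem memLp_polyGrad (hZ : IsComplexIsonormal Z P) (e : ι → H) (p : ConjPoly ι) {r : ℝ≥0∞}
    (hr : r ≠ ∞) : MemLp (polyGrad Z e p) r P :=
  memLp_finsetSum _ fun i _ => memLp_smul_const (memLp_polyVar hZ e (dz i p) hr) (e i)

theorem mem_smoothGraph_polyVar (hZ : IsComplexIsonormal Z P) (e : ι → H) (p : ConjPoly ι) :
    ((memLp_polyVar hZ e p (r := 2) (by simp)).toLp,
      (memLp_polyGrad hZ e p (r := 2) (by simp)).toLp) ∈ smoothGraph Z P := by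
  obtain ⟨q, hq, hq'⟩ := exists_polyVar_eq (Z := Z) (e := e) (Finset.Subset.refl (polySupp p))
  refine ⟨_, fun z => polyEval z q, fun j => e (finEnum (polySupp p) j),
    hasTemperateGrowth_polyEval q, ?_, ?_⟩
  · filter_upwards [(memLp_polyVar hZ e p (r := 2) (by simp)).coeFn_toLp] with ω hω
    rw [hω, hq]
  · filter_upwards [(memLp_polyGrad hZ e p (r := 2) (by simp)).coeFn_toLp] with ω hω
    simp only [hω, ← hq']
    exact (sum_finEnum (polySupp p) fun i => polyVar Z e (dz i p) ω • e i).symm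

theorem integrable_polyVar (hZ : IsComplexIsonormal Z P) (e : ι → H) (p : ConjPoly ι) :
    Integrable (polyVar Z e p) P :=
  memLp_one_iff_integrable.1 (memLp_polyVar hZ e p (by simp))

/-- The expectation of a polynomial random variable. -/
def polyExp (P : Measure Ω) (Z : H → Ω → ℂ) (e : ι → H) (p : ConjPoly ι) : ℂ :=
  ∫ ω, polyVar Z e p ω ∂P

theorem polyExp_add (hZ : IsComplexIsonormal Z P) (p q : ConjPoly ι) :
    polyExp P Z e (p + q) = polyExp P Z e p + polyExp P Z e q := by
  unfold polyExp
  rw [← integral_add (integrable_polyVar hZ e p) (integrable_polyVar hZ e q)]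
  simp [polyVar]

theorem polyExp_smul (c : ℂ) (p : ConjPoly ι) :
    polyExp P Z e (c • p) = c * polyExp P Z e p := by
  unfold polyExp
  rw [← integral_const_mul]
  simp [polyVar]

theorem polyExp_sum (hZ : IsComplexIsonormal Z P) {σ : Type*} (s : Finset σ)
    (p : σ → ConjPoly ι) : polyExp P Z e (∑ i ∈ s, p i) = ∑ i ∈ s, polyExp P Z e (p i) := by
  unfold polyExp
  rw [← integral_finsetSum _ fun i _ => integrable_polyVar hZ e (p i)]
  simp [polyVar]

theorem polyExp_polyBar (p : ConjPoly ι) :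
    polyExp P Z e (polyBar p) = starRingEnd ℂ (polyExp P Z e p) := by
  unfold polyExp
  rw [← integral_conj]
  simp [polyVar]

/-- Integration by parts against `Z (e i)`: orthonormality leaves only the `i`-th derivative. The
index `i` is added to the variables because it need not occur in `r`. -/
theorem polyExp_dz (hZ : IsComplexIsonormal Z P) (he : Orthonormal ℂ e) (i : ι)
    (r : ConjPoly ι) :
    polyExp P Z e (dz i r) = polyExp P Z e (MvPolynomial.X (Sum.inr i) * r) := by
  classical
  obtain ⟨q, hq, hq'⟩ := exists_polyVar_eq (Z := Z) (e := e)
    (Finset.subset_insert i (polySupp r))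
  have key := hZ.integral_conj_mul (fun j => e (finEnum (insert i (polySupp r)) j)) (e i)
    (hasTemperateGrowth_polyEval q)
  simp only [dirWirtinger_eq_sum, ← hq, ← hq'] at key
  unfold polyExp
  simp only [polyVar, map_mul, polyEval_inr] at key ⊢
  rw [key]
  congr 1
  ext ω
  rw [sum_finEnum (insert i (polySupp r)) fun j =>
    polyEval (fun i => Z (e i) ω) (dz j r) * inner ℂ (e i) (e j)]
  rw [Finset.sum_eq_single i]
  · simp [inner_self_eq_norm_sq_to_K, he.1 i]
  · intro j _ hj
    rw [he.2 hj.symm, mul_zero]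
  · intro h; exact absurd (Finset.mem_insert_self _ _) h

/-- The adjoint of `∂_i` is `z_i - ∂̄_i`, by Leibniz and `∂_i (conj f) = conj (∂̄_i f)`. -/
theorem polyExp_dz_mul_polyBar (hZ : IsComplexIsonormal Z P) (he : Orthonormal ℂ e) (i : ι)
    (q f : ConjPoly ι) :
    polyExp P Z e (dz i q * polyBar f)
      = polyExp P Z e (q * polyBar (MvPolynomial.X (Sum.inl i) * f - dzbar i f)) := by
  have h := polyExp_dz hZ he i (q * polyBar f)
  rw [Derivation.leibniz, dz_polyBar, polyExp_add hZ] at h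
  have e1 : q * polyBar (MvPolynomial.X (Sum.inl i) * f - dzbar i f)
      = MvPolynomial.X (Sum.inr i) * (q * polyBar f) + (-1 : ℂ) • (q * polyBar (dzbar i f)) := by
    rw [map_sub, map_mul, polyBar_inl, neg_one_smul]; ring
  rw [e1, polyExp_add hZ, polyExp_smul, ← h, mul_comm (dz i q)]
  simp only [smul_eq_mul]
  ring

/-- `E⟨DF, DG⟩ = m E[F conj G]` for `F` in the `(m, n)`-th chaos. -/
theorem sum_polyExp_dz (hZ : IsComplexIsonormal Z P) (he : Orthonormal ℂ e) {m n : ℕ}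
    {p : ConjPoly ι} (hp : p ∈ chaos ι m n) {s : Finset ι} (hs : polySupp p ⊆ s)
    (q : ConjPoly ι) :
    ∑ i ∈ s, polyExp P Z e (dz i p * polyBar (dz i q)) = m * polyExp P Z e (p * polyBar q) := by
  -- The roles of `p` and `q` are exchanged so that the adjoint falls on `∂_i p` and produces the
  -- number operator of `p`, leaving `q` arbitrary. Conjugation restores the order.
  have h : ∑ i ∈ s, polyExp P Z e (dz i q * polyBar (dz i p))
      = m * polyExp P Z e (q * polyBar p) := by
    simp only [polyExp_dz_mul_polyBar hZ he]
    rw [← polyExp_sum hZ, ← Finset.mul_sum, ← map_sum, number_of_mem_chaos hp hs, polyBar_smul,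
      mul_smul_comm, polyExp_smul, map_natCast]
  have h' := congrArg (starRingEnd ℂ) h
  rw [map_sum, map_mul, map_natCast] at h'
  simpa only [← polyExp_polyBar, map_mul, polyBar_polyBar, mul_comm] using h'

end RandomVariables


/-! ### Fourth moment identity and hypercontractivity for polynomials. -/

section Hypercontractivity

/-- Cauchy–Schwarz, from the sign of the discriminant of `t ↦ E[(t f + g)²]`. -/
theorem sq_integral_mul_le {Ω : Type*} [MeasurableSpace Ω] {P : Measure Ω} {f g : Ω → ℝ}
    (hf : Integrable (fun ω => f ω ^ 2) P) (hg : Integrable (fun ω => g ω ^ 2) P)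
    (hfg : Integrable (fun ω => f ω * g ω) P) :
    (∫ ω, f ω * g ω ∂P) ^ 2 ≤ (∫ ω, f ω ^ 2 ∂P) * ∫ ω, g ω ^ 2 ∂P := by
  have h : ∀ t : ℝ, 0 ≤ (∫ ω, f ω ^ 2 ∂P) * (t * t) + (2 * ∫ ω, f ω * g ω ∂P) * t
      + ∫ ω, g ω ^ 2 ∂P := by
    intro t
    have e : ∫ ω, (f ω * t + g ω) ^ 2 ∂P = (∫ ω, f ω ^ 2 ∂P) * (t * t)
        + (2 * ∫ ω, f ω * g ω ∂P) * t + ∫ ω, g ω ^ 2 ∂P := by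
      have h1 : Integrable (fun ω => f ω ^ 2 * (t * t)) P := hf.mul_const _
      have h2 : Integrable (fun ω => f ω * g ω * (2 * t)) P := hfg.mul_const _
      have h3 : Integrable (fun ω => f ω ^ 2 * (t * t) + f ω * g ω * (2 * t)) P := h1.add h2
      have : ∀ ω, (f ω * t + g ω) ^ 2
          = f ω ^ 2 * (t * t) + f ω * g ω * (2 * t) + g ω ^ 2 := fun ω => by ring
      simp only [this]
      rw [integral_add h3 hg, integral_add h1 h2, integral_mul_const, integral_mul_const]
      ring
    rw [← e]
    exact integral_nonneg fun ω => sq_nonneg _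
  have := discrim_le_zero h
  rw [discrim] at this
  nlinarith

variable {ι : Type*} {H : Type*} [NormedAddCommGroup H] [InnerProductSpace ℂ H]
  {Ω : Type*} [MeasurableSpace Ω] {P : Measure Ω} {Z : H → Ω → ℂ} {e : ι → H}

set_option linter.unusedSectionVars false

theorem inner_polyGrad (he : Orthonormal ℂ e) {p q : ConjPoly ι} {s : Finset ι}
    (hp : polySupp p ⊆ s) (hq : polySupp q ⊆ s) (ω : Ω) :
    inner ℂ (polyGrad Z e p ω) (polyGrad Z e q ω)
      = ∑ i ∈ s, starRingEnd ℂ (polyVar Z e (dz i p) ω) * polyVar Z e (dz i q) ω := by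
  rw [polyGrad_eq_sum hp, polyGrad_eq_sum hq, he.inner_sum]

theorem norm_polyGrad_sq (he : Orthonormal ℂ e) {p : ConjPoly ι} {s : Finset ι}
    (hp : polySupp p ⊆ s) (ω : Ω) :
    ‖polyGrad Z e p ω‖ ^ 2 = ∑ i ∈ s, ‖polyVar Z e (dz i p) ω‖ ^ 2 := by
  have h := inner_polyGrad (Z := Z) he hp hp ω
  rw [inner_self_eq_norm_sq_to_K] at h
  simp only [Complex.conj_mul'] at h
  refine Complex.ofReal_injective ?_
  rw [Complex.ofReal_pow, Complex.ofReal_sum]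
  simp only [Complex.ofReal_pow]
  exact h

/-- The fourth moment identity for polynomials in the `(m, n)`-th chaos. -/
theorem fourth_moment_polyVar (hZ : IsComplexIsonormal Z P) (he : Orthonormal ℂ e) {m n : ℕ}
    {p : ConjPoly ι} (hp : p ∈ chaos ι m n) :
    (m : ℂ) * ∫ ω, (‖polyVar Z e p ω‖ : ℂ) ^ 4 ∂P
      = ∫ ω, (2 * (‖polyGrad Z e p ω‖ : ℂ) ^ 2 * (‖polyVar Z e p ω‖ : ℂ) ^ 2
          + inner ℂ (polyGrad Z e (polyBar p) ω) (polyGrad Z e p ω)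
            * starRingEnd ℂ (polyVar Z e p ω) ^ 2) ∂P := by
  classical
  set s := polySupp p ∪ polySupp (polyBar p) with hs
  have h1 : polySupp p ⊆ s := Finset.subset_union_left
  have h2 : polySupp (polyBar p) ⊆ s := Finset.subset_union_right
  -- The test polynomial `p² conj p` turns `p conj q` into `|p|⁴`; Leibniz yields the two terms of
  -- the identity.
  have key := sum_polyExp_dz hZ he hp h1 (p * p * polyBar p)
  rw [← polyExp_sum hZ] at key
  unfold polyExp at key
  have e1 : ∀ ω, polyVar Z e (p * polyBar (p * p * polyBar p)) ω
      = (‖polyVar Z e p ω‖ : ℂ) ^ 4 := by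
    intro ω
    have : (‖polyVar Z e p ω‖ : ℂ) ^ 4 = ((‖polyVar Z e p ω‖ : ℂ) ^ 2) ^ 2 := by ring
    rw [this, ← Complex.conj_mul']
    simp only [polyVar, map_mul, polyEval_polyBar, polyBar_polyBar]
    ring
  simp only [e1] at key
  rw [← key]
  congr 1
  ext ω
  have e2 : (‖polyGrad Z e p ω‖ : ℂ) ^ 2
      = ∑ i ∈ s, starRingEnd ℂ (polyVar Z e (dz i p) ω) * polyVar Z e (dz i p) ω := by
    rw [← inner_polyGrad he h1 h1, inner_self_eq_norm_sq_to_K]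
    rfl
  rw [e2, inner_polyGrad he h2 h1, ← Complex.conj_mul' (polyVar Z e p ω)]
  simp only [polyVar, map_sum, map_mul, Derivation.leibniz, map_add, smul_eq_mul,
    polyEval_polyBar, polyBar_polyBar, Finset.mul_sum, Finset.sum_mul, ← Finset.sum_add_distrib]
  refine Finset.sum_congr rfl fun i _ => ?_
  ring

theorem integral_norm_polyGrad_sq (hZ : IsComplexIsonormal Z P) (he : Orthonormal ℂ e) {m n : ℕ}
    {p : ConjPoly ι} (hp : p ∈ chaos ι m n) {s : Finset ι} (hs : polySupp p ⊆ s) :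
    ∑ i ∈ s, ∫ ω, ‖polyVar Z e (dz i p) ω‖ ^ 2 ∂P = m * ∫ ω, ‖polyVar Z e p ω‖ ^ 2 ∂P := by
  have h := sum_polyExp_dz hZ he hp hs p
  have hq : ∀ q : ConjPoly ι, polyExp P Z e (q * polyBar q)
      = ((∫ ω, ‖polyVar Z e q ω‖ ^ 2 ∂P : ℝ) : ℂ) := by
    intro q
    rw [← integral_complex_ofReal]
    unfold polyExp
    congr 1; ext ω
    simp only [polyVar, map_mul, polyEval_polyBar, Complex.mul_conj']
    push_cast; rfl
  simp only [hq] at h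
  exact_mod_cast h

theorem integrable_norm_pow_mul (hZ : IsComplexIsonormal Z P) (e : ι → H) (p q : ConjPoly ι)
    (j k : ℕ) : Integrable (fun ω => ‖polyVar Z e p ω‖ ^ j * ‖polyVar Z e q ω‖ ^ k) P := by
  have := hZ.gaussian.isProbabilityMeasure
  have h := memLp_one_iff_integrable.1 (memLp_mul_of_forall
    (memLp_pow_of_forall (fun r hr => memLp_polyVar hZ e p hr) j)
    (memLp_pow_of_forall (fun r hr => memLp_polyVar hZ e q hr) k) 1 (by simp))
  simpa using h.norm

theorem integrable_norm_pow (hZ : IsComplexIsonormal Z P) (e : ι → H) (p : ConjPoly ι) (j : ℕ) :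
    Integrable (fun ω => ‖polyVar Z e p ω‖ ^ j) P := by
  simpa using integrable_norm_pow_mul hZ e p 0 j 0

/-- Expand the square and apply Cauchy–Schwarz to each cross term. The constant does not depend on
the size of `s`, which matters because gradients may have any number of coordinates. -/
theorem integral_sq_sum_le (hZ : IsComplexIsonormal Z P) {C : ℝ} (hC : 0 ≤ C) {s : Finset ι}
    {q : ι → ConjPoly ι}
    (hq : ∀ i ∈ s, ∫ ω, ‖polyVar Z e (q i) ω‖ ^ 4 ∂P
      ≤ C * (∫ ω, ‖polyVar Z e (q i) ω‖ ^ 2 ∂P) ^ 2) :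
    ∫ ω, (∑ i ∈ s, ‖polyVar Z e (q i) ω‖ ^ 2) ^ 2 ∂P
      ≤ C * (∑ i ∈ s, ∫ ω, ‖polyVar Z e (q i) ω‖ ^ 2 ∂P) ^ 2 := by
  have hexp : ∀ a : ι → ℝ, (∑ i ∈ s, a i) ^ 2 = ∑ i ∈ s, ∑ j ∈ s, a i * a j := fun a => by
    rw [sq, Finset.sum_mul_sum]
  simp only [hexp, Finset.mul_sum]
  rw [integral_finsetSum _ fun i _ => integrable_finsetSum _ fun j _ =>
    integrable_norm_pow_mul hZ e (q i) (q j) 2 2]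
  refine Finset.sum_le_sum fun i hi => ?_
  rw [integral_finsetSum _ fun j _ => integrable_norm_pow_mul hZ e (q i) (q j) 2 2]
  refine Finset.sum_le_sum fun j hj => ?_
  have hpow : ∀ k, ∀ ω, (‖polyVar Z e (q k) ω‖ ^ 2) ^ 2 = ‖polyVar Z e (q k) ω‖ ^ 4 :=
    fun k ω => by ring
  have hcs := sq_integral_mul_le (P := P) (f := fun ω => ‖polyVar Z e (q i) ω‖ ^ 2)
    (g := fun ω => ‖polyVar Z e (q j) ω‖ ^ 2)
    (by simpa only [hpow] using integrable_norm_pow hZ e (q i) 4)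
    (by simpa only [hpow] using integrable_norm_pow hZ e (q j) 4)
    (integrable_norm_pow_mul hZ e (q i) (q j) 2 2)
  simp only [hpow] at hcs
  have hi0 : 0 ≤ ∫ ω, ‖polyVar Z e (q i) ω‖ ^ 2 ∂P := integral_nonneg fun _ => by positivity
  have hj0 : 0 ≤ ∫ ω, ‖polyVar Z e (q j) ω‖ ^ 2 ∂P := integral_nonneg fun _ => by positivity
  refine abs_le_of_sq_le_sq' ?_ (by positivity) |>.2
  calc _ ≤ _ := hcs
    _ ≤ (C * (∫ ω, ‖polyVar Z e (q i) ω‖ ^ 2 ∂P) ^ 2)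
        * (C * (∫ ω, ‖polyVar Z e (q j) ω‖ ^ 2 ∂P) ^ 2) :=
      mul_le_mul (hq i hi) (hq j hj) (integral_nonneg fun _ => by positivity) (by positivity)
    _ = _ := by ring

theorem integrable_norm_polyGrad_pow (hZ : IsComplexIsonormal Z P) (e : ι → H) (p : ConjPoly ι) :
    Integrable (fun ω => ‖polyGrad Z e p ω‖ ^ 4) P :=
  (memLp_polyGrad hZ e p (r := 4) (by simp)).integrable_norm_pow (by simp)

/-- The fourth moment in a chaos is controlled by the fourth moments of the derivatives. -/
theorem integral_norm_pow_four_le (hZ : IsComplexIsonormal Z P) (he : Orthonormal ℂ e) {m n : ℕ}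
    (hm : 1 ≤ m) {p : ConjPoly ι} (hp : p ∈ chaos ι m n) :
    ∫ ω, ‖polyVar Z e p ω‖ ^ 4 ∂P
      ≤ 18 * ∫ ω, ‖polyGrad Z e p ω‖ ^ 4 ∂P + 2 * ∫ ω, ‖polyGrad Z e (polyBar p) ω‖ ^ 4 ∂P := by
  have h := congrArg norm (fourth_moment_polyVar hZ he hp)
  have hX0 : 0 ≤ ∫ ω, ‖polyVar Z e p ω‖ ^ 4 ∂P := integral_nonneg fun _ => by positivity
  have e1 : ∫ ω, (‖polyVar Z e p ω‖ : ℂ) ^ 4 ∂P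
      = ((∫ ω, ‖polyVar Z e p ω‖ ^ 4 ∂P : ℝ) : ℂ) := by
    rw [← integral_complex_ofReal]; push_cast; rfl
  rw [e1, norm_mul, Complex.norm_natCast, Complex.norm_real, Real.norm_of_nonneg hX0] at h
  have i1 := integrable_norm_polyGrad_pow hZ e p
  have i2 := integrable_norm_polyGrad_pow hZ e (polyBar p)
  have i3 := integrable_norm_pow hZ e p 4
  have i12 : Integrable (fun ω => 9 * ‖polyGrad Z e p ω‖ ^ 4
      + ‖polyGrad Z e (polyBar p) ω‖ ^ 4) P := (i1.const_mul 9).add i2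
  -- With `A`, `B`, `c` the norms of `Dp`, `D(conj p)`, `p`: the integrand is at most `(3A² + B²)c²
  -- ≤ (3A² + B²)²/2 + c⁴/2 ≤ 9A⁴ + B⁴ + c⁴/2`. Since `m ≥ 1`, the last term is absorbed on the
  -- left, which doubles the constants to `18` and `2`.
  have hb := norm_integral_le_of_norm_le (μ := P)
    (f := fun ω => 2 * (‖polyGrad Z e p ω‖ : ℂ) ^ 2 * (‖polyVar Z e p ω‖ : ℂ) ^ 2
          + inner ℂ (polyGrad Z e (polyBar p) ω) (polyGrad Z e p ω)
            * starRingEnd ℂ (polyVar Z e p ω) ^ 2)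
    (g := fun ω => 9 * ‖polyGrad Z e p ω‖ ^ 4 + ‖polyGrad Z e (polyBar p) ω‖ ^ 4
      + (1 / 2) * ‖polyVar Z e p ω‖ ^ 4) (i12.add (i3.const_mul _)) (.of_forall fun ω => by
      have hin := norm_inner_le_norm (𝕜 := ℂ) (polyGrad Z e (polyBar p) ω) (polyGrad Z e p ω)
      refine (norm_add_le _ _).trans ?_
      simp only [norm_mul, norm_pow, Complex.norm_real, norm_norm, RCLike.norm_conj]
      rw [Complex.norm_ofNat]
      have := mul_le_mul_of_nonneg_right hin (sq_nonneg ‖polyVar Z e p ω‖)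
      set A := ‖polyGrad Z e p ω‖
      set B := ‖polyGrad Z e (polyBar p) ω‖
      set c := ‖polyVar Z e p ω‖
      have hc2 : 0 ≤ c ^ 2 := sq_nonneg _
      have h3 : B * A * c ^ 2 ≤ (A ^ 2 + B ^ 2) * c ^ 2 := by
        gcongr
        nlinarith [sq_nonneg (A - B), sq_nonneg A, sq_nonneg B]
      nlinarith [sq_nonneg (3 * A ^ 2 + B ^ 2 - c ^ 2), sq_nonneg (3 * A ^ 2 - B ^ 2)])
  rw [integral_add i12 (i3.const_mul _), integral_add (i1.const_mul 9) i2, integral_const_mul,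
    integral_const_mul, ← h] at hb
  have : (1 : ℝ) ≤ m := by exact_mod_cast hm
  nlinarith

/-- **Hypercontractivity** on a fixed chaos. -/
theorem exists_hypercontractive (hZ : IsComplexIsonormal Z P) (he : Orthonormal ℂ e) (N : ℕ) :
    ∀ m n : ℕ, m + n = N → ∃ C : ℝ, 0 ≤ C ∧ ∀ p ∈ chaos ι m n,
      ∫ ω, ‖polyVar Z e p ω‖ ^ 4 ∂P ≤ C * (∫ ω, ‖polyVar Z e p ω‖ ^ 2 ∂P) ^ 2 := by
  have := hZ.gaussian.isProbabilityMeasure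
  induction N with
  | zero =>
    intro m n hmn
    obtain ⟨rfl, rfl⟩ : m = 0 ∧ n = 0 := by omega
    refine ⟨1, zero_le_one, fun p hp => ?_⟩
    obtain ⟨c, rfl⟩ := exists_C_of_mem_chaos_zero hp
    simp only [polyVar, polyEval_C, integral_const, probReal_univ, one_smul, one_mul]
    exact le_of_eq (by ring)
  | succ N ih =>
    -- The coordinates of the gradient lie in the chaos `(m - 1, n)`, where the induction hypothesis
    -- applies, and their second moments add up to `m E|p|²`.
    have grad : ∀ m n : ℕ, m + n = N + 1 → ∃ C : ℝ, 0 ≤ C ∧ ∀ p ∈ chaos ι m n,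
        ∫ ω, ‖polyGrad Z e p ω‖ ^ 4 ∂P ≤ C * (∫ ω, ‖polyVar Z e p ω‖ ^ 2 ∂P) ^ 2 := by
      intro m n hmn
      rcases m with _ | m
      · refine ⟨0, le_rfl, fun p hp => ?_⟩
        have : ∀ ω, polyGrad Z e p ω = 0 := fun ω =>
          Finset.sum_eq_zero fun i _ => by rw [dz_chaos_zero hp]; simp [polyVar]
        simp [this]
      · obtain ⟨C, hC, h⟩ := ih m n (by omega)
        refine ⟨C * ((m + 1 : ℕ) : ℝ) ^ 2, by positivity, fun p hp => ?_⟩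
        have h1 := integral_sq_sum_le hZ hC (s := polySupp p) (q := fun i => dz i p)
          fun i _ => h _ (dz_mem_chaos hp i)
        rw [integral_norm_polyGrad_sq hZ he hp (Finset.Subset.refl _)] at h1
        simp only [← norm_polyGrad_sq he (Finset.Subset.refl _)] at h1
        calc _ = ∫ ω, (‖polyGrad Z e p ω‖ ^ 2) ^ 2 ∂P := by congr 1; ext ω; ring
          _ ≤ _ := h1
          _ = _ := by ring
    have main : ∀ m n : ℕ, 1 ≤ m → m + n = N + 1 → ∃ C : ℝ, 0 ≤ C ∧ ∀ p ∈ chaos ι m n,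
        ∫ ω, ‖polyVar Z e p ω‖ ^ 4 ∂P ≤ C * (∫ ω, ‖polyVar Z e p ω‖ ^ 2 ∂P) ^ 2 := by
      intro m n hm hmn
      obtain ⟨C₁, hC₁, h₁⟩ := grad m n hmn
      obtain ⟨C₂, hC₂, h₂⟩ := grad n m (by omega)
      refine ⟨18 * C₁ + 2 * C₂, by positivity, fun p hp => ?_⟩
      have h3 := h₂ _ (polyBar_mem_chaos hp)
      have e1 : ∀ ω, ‖polyVar Z e (polyBar p) ω‖ = ‖polyVar Z e p ω‖ := fun ω => by
        simp [polyVar]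
      simp only [e1] at h3
      linarith [integral_norm_pow_four_le hZ he hm hp, h₁ p hp]
    intro m n hmn
    -- For `m = 0` the identity carries no information, but `conj p` has the same modulus and lies
    -- in the chaos `(n, 0)`.
    rcases m with _ | m
    · obtain ⟨C, hC, h⟩ := main n 0 (by omega) (by omega)
      refine ⟨C, hC, fun p hp => ?_⟩
      have := h _ (polyBar_mem_chaos hp)
      simpa [polyVar] using this
    · exact main (m + 1) n (by omega) hmn

/-- The fourth moment of the derivative on a fixed chaos. -/
theorem exists_hypercontractive_polyGrad (hZ : IsComplexIsonormal Z P) (he : Orthonormal ℂ e)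
    (m n : ℕ) : ∃ C : ℝ, 0 ≤ C ∧ ∀ p ∈ chaos ι m n,
      ∫ ω, ‖polyGrad Z e p ω‖ ^ 4 ∂P ≤ C * (∫ ω, ‖polyVar Z e p ω‖ ^ 2 ∂P) ^ 2 := by
  obtain ⟨C, hC, h⟩ := exists_hypercontractive (ι := ι) hZ he _ (m - 1) n rfl
  refine ⟨C * (m : ℝ) ^ 2, by positivity, fun p hp => ?_⟩
  have h1 := integral_sq_sum_le hZ hC (s := polySupp p) (q := fun i => dz i p)
    fun i _ => h _ (dz_mem_chaos hp i)
  rw [integral_norm_polyGrad_sq hZ he hp (Finset.Subset.refl _)] at h1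
  simp only [← norm_polyGrad_sq he (Finset.Subset.refl _)] at h1
  calc _ = ∫ ω, (‖polyGrad Z e p ω‖ ^ 2) ^ 2 ∂P := by congr 1; ext ω; ring
    _ ≤ _ := h1
    _ = _ := by ring

end Hypercontractivity


/-! ### Multiple integrals as limits of chaos polynomials. -/

section WienerIto

variable {ι : Type*} {H : Type*} [NormedAddCommGroup H] [InnerProductSpace ℂ H]
  {Ω : Type*} [MeasurableSpace Ω] {P : Measure Ω} {Z : H → Ω → ℂ}

set_option linter.unusedSectionVars false

/-- Beyond `min m n` a binomial coefficient vanishes, so sums for different indices can share one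
range. -/
theorem complexHermite_eq_sum_range {m n N : ℕ} (hN : m + 1 ≤ N) (z : ℂ) (ρ : ℝ) :
    complexHermite m n z ρ = ∑ r ∈ Finset.range N, (-1) ^ r * (r ! : ℂ) * (m.choose r : ℂ)
      * (n.choose r : ℂ) * z ^ (m - r) * starRingEnd ℂ z ^ (n - r) * (ρ : ℂ) ^ r := by
  refine Finset.sum_subset (Finset.range_mono (by omega)) fun r _ hr => ?_
  rw [Finset.mem_range, not_lt] at hr
  rcases le_total m n with h | h
  · rw [Nat.choose_eq_zero_of_lt (n := m) (k := r) (by omega)]; simp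
  · rw [Nat.choose_eq_zero_of_lt (n := n) (k := r) (by omega)]; simp

/-- Compare coefficients, using Pascal's rule and `(r + 1) C(n, r + 1) = n C(n - 1, r)`. -/
theorem complexHermite_succ_left (m n : ℕ) (z : ℂ) (ρ : ℝ) :
    complexHermite (m + 1) n z ρ
      = z * complexHermite m n z ρ - ρ * n * complexHermite m (n - 1) z ρ := by
  rw [complexHermite_eq_sum_range (le_refl (m + 1 + 1)),
    complexHermite_eq_sum_range (m := m) (n := n) (N := m + 1 + 1) (by omega),
    complexHermite_eq_sum_range (m := m) (n := n - 1) (le_refl (m + 1)),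
    Finset.sum_range_succ' _ (m + 1), Finset.sum_range_succ' _ (m + 1), mul_add, Finset.mul_sum,
    Finset.mul_sum, add_sub_right_comm, ← Finset.sum_sub_distrib]
  congr 1
  · refine Finset.sum_congr rfl fun r hr => ?_
    have hr' : r ≤ m := by simpa [Nat.lt_succ_iff] using hr
    have hz : (m.choose (r + 1) : ℂ) * z ^ (m - r)
        = (m.choose (r + 1) : ℂ) * (z * z ^ (m - (r + 1))) := by
      rcases hr'.eq_or_lt with h | h
      · simp [h]
      · rw [← pow_succ', show m - (r + 1) + 1 = m - r by omega]
    have hn : ((r + 1 : ℕ) : ℂ) * (n.choose (r + 1) : ℂ) = n * ((n - 1).choose r : ℂ) := by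
      rcases n with _ | n
      · simp
      · rw [Nat.add_sub_cancel, mul_comm]
        exact_mod_cast (Nat.add_one_mul_choose_eq n r).symm
    rw [Nat.choose_succ_succ, Nat.factorial_succ, show m + 1 - (r + 1) = m - r by omega,
      show n - (r + 1) = n - 1 - r by omega]
    push_cast at hn ⊢
    linear_combination ((-1) ^ (r + 1) * ((r : ℂ) + 1) * (r ! : ℂ) * (n.choose (r + 1) : ℂ)
        * starRingEnd ℂ z ^ (n - 1 - r) * (ρ : ℂ) ^ (r + 1)) * hz
      + ((-1) ^ (r + 1) * (r ! : ℂ) * (m.choose r : ℂ) * z ^ (m - r)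
        * starRingEnd ℂ z ^ (n - 1 - r) * (ρ : ℂ) ^ (r + 1)) * hn
  · simp; ring

/-- The scaling `J_{a,b}(√ρ z, ρ) = √ρ^{a+b} J_{a,b}(z, 1)` at `ρ = 2`, obtained by matching
recursions. -/
theorem complexHermite_sqrt_two (i : ι) (a b : ℕ) (z : ι → ℂ) :
    complexHermite a b ((Real.sqrt 2 : ℂ) * z i) 2
      = (Real.sqrt 2 : ℂ) ^ (a + b) * polyEval z (hermitePoly i a b) := by
  have h2 : (Real.sqrt 2 : ℂ) ^ 2 = 2 := by
    rw [← Complex.ofReal_pow, Real.sq_sqrt (by norm_num)]; norm_num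
  induction a generalizing b with
  | zero => simp [complexHermite, hermitePoly, mul_pow]
  | succ a ih =>
    rw [complexHermite_succ_left, ih, ih, hermitePoly_succ_left]
    simp only [map_sub, map_mul, polyEval_inl, map_natCast]
    rcases b with _ | b
    · simp; ring
    · simp only [Nat.add_sub_cancel]
      push_cast
      rw [show a + 1 + (b + 1) = a + b + 2 by ring, pow_add _ (a + b) 2, h2,
        show a + (b + 1) = a + b + 1 by ring, pow_add _ (a + b) 1]
      linear_combination ((Real.sqrt 2 : ℂ) ^ (a + b) * z i
        * polyEval z (hermitePoly i a (b + 1))) * h2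

/-- Only membership in the chaos is needed later, so the normalizing constant is left unspecified.
-/
theorem exists_fourierHermite_eq (Z : H → Ω → ℂ) (e : ι → H) (a b : ι →₀ ℕ) :
    ∃ c : ℂ, fourierHermite Z e a b = polyVar Z e (c • multiHermite a b) := by
  classical
  refine ⟨∏ k ∈ a.support ∪ b.support,
    ((Real.sqrt ((2 ^ (a k + b k) * (a k)! * (b k)! : ℕ) : ℝ))⁻¹ : ℂ)
      * (Real.sqrt 2 : ℂ) ^ (a k + b k), ?_⟩
  ext ω
  rw [polyVar, map_smul, multiHermite, map_prod, smul_eq_mul, ← Finset.prod_mul_distrib,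
    fourierHermite]
  have h : ∀ k ∈ a.support ∪ b.support,
      ((Real.sqrt ((2 ^ (a k + b k) * (a k)! * (b k)! : ℕ) : ℝ))⁻¹ : ℂ)
        * complexHermite (a k) (b k) ((Real.sqrt 2 : ℂ) * Z (e k) ω) 2
      = ((Real.sqrt ((2 ^ (a k + b k) * (a k)! * (b k)! : ℕ) : ℝ))⁻¹ : ℂ)
        * (Real.sqrt 2 : ℂ) ^ (a k + b k)
        * polyEval (fun i => Z (e i) ω) (hermitePoly k (a k) (b k)) := fun k _ => by
    rw [complexHermite_sqrt_two k (a k) (b k) (fun i => Z (e i) ω)]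
    ring
  convert Finset.prod_congr rfl h

theorem degree_multiIndex {k : ℕ} (j : Fin k → ι) : (multiIndex j).degree = k := by
  simp [multiIndex]

/-- `polyVar` as a linear map into `L^r`. -/
def polyLp (hZ : IsComplexIsonormal Z P) (e : ι → H) (r : ℝ≥0∞) (hr : r ≠ ∞) :
    ConjPoly ι →ₗ[ℂ] Lp ℂ r P where
  toFun p := (memLp_polyVar hZ e p hr).toLp
  map_add' p q := by
    rw [← MemLp.toLp_add]
    exact MemLp.toLp_congr _ _ (.of_forall fun ω => by simp [polyVar])
  map_smul' c p := by
    rw [RingHom.id_apply, ← MemLp.toLp_const_smul]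
    exact MemLp.toLp_congr _ _ (.of_forall fun ω => by simp [polyVar])

theorem coeFn_polyLp (hZ : IsComplexIsonormal Z P) (e : ι → H) (r : ℝ≥0∞) (hr : r ≠ ∞)
    (p : ConjPoly ι) : polyLp hZ e r hr p =ᵐ[P] polyVar Z e p :=
  (memLp_polyVar hZ e p hr).coeFn_toLp

/-- Multiple integrals are `L²`-limits of polynomials in the chaos. -/
theorem wienerIto_mem_closure [CompleteSpace H] (hZ : IsComplexIsonormal Z P)
    (conj : H ≃ₗᵢ⋆[ℂ] H) (e : HilbertBasis ι ℂ H) (m n : ℕ) (f : HTensor H (m + n)) :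
    wienerIto hZ conj e m n f
      ∈ ((chaos ι m n).map (polyLp hZ e 2 (by simp))).topologicalClosure := by
  -- No summability is required: a closed subspace contains the sum of a convergent series, and also
  -- the default value `0`.
  refine tsum_mem (Submodule.isClosed_topologicalClosure _) fun p => ?_
  refine Submodule.smul_mem _ _ (Submodule.le_topologicalClosure _ ?_)
  obtain ⟨c, hc⟩ := exists_fourierHermite_eq Z e (multiIndex p.1) (multiIndex p.2)
  refine ⟨c • multiHermite (multiIndex p.1) (multiIndex p.2), Submodule.smul_mem _ _
    (Submodule.subset_span ⟨_, _, degree_multiIndex _, degree_multiIndex _, rfl⟩), ?_⟩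
  exact MemLp.toLp_congr (memLp_polyVar hZ e _ (by simp)) _ (.of_forall fun ω => by rw [hc])

/-- The Malliavin derivative of a polynomial random variable as an element of `L^r`. -/
def polyGradLp (hZ : IsComplexIsonormal Z P) (e : ι → H) (r : ℝ≥0∞) (hr : r ≠ ∞)
    (p : ConjPoly ι) : Lp H r P :=
  (memLp_polyGrad hZ e p hr).toLp

theorem coeFn_polyGradLp (hZ : IsComplexIsonormal Z P) (e : ι → H) (r : ℝ≥0∞) (hr : r ≠ ∞)
    (p : ConjPoly ι) : polyGradLp hZ e r hr p =ᵐ[P] polyGrad Z e p :=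
  (memLp_polyGrad hZ e p hr).coeFn_toLp

theorem polyGradLp_sub (hZ : IsComplexIsonormal Z P) (e : ι → H) (r : ℝ≥0∞) (hr : r ≠ ∞)
    (p q : ConjPoly ι) :
    polyGradLp hZ e r hr (p - q) = polyGradLp hZ e r hr p - polyGradLp hZ e r hr q := by
  unfold polyGradLp
  rw [← MemLp.toLp_sub]
  exact MemLp.toLp_congr _ _ (.of_forall fun ω => by rw [polyGrad_sub])

end WienerIto

/-! ### Products of `L⁴` functions. -/

section LFour

instance fact_one_le_four_ennreal : Fact ((1 : ℝ≥0∞) ≤ 4) := ⟨by norm_num⟩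

instance holderTriple_four_four_two : ENNReal.HolderTriple 4 4 2 := ⟨by
  have h : (4 : ℝ≥0∞) = 2 * 2 := by norm_num
  rw [h, ENNReal.mul_inv (by simp) (by simp), ← add_mul, ENNReal.inv_two_add_inv_two, one_mul]⟩

variable {E : Type*} [NormedAddCommGroup E] {Ω : Type*} [MeasurableSpace Ω] {P : Measure Ω}

theorem norm_toLp_pow {k : ℕ} (hk : k ≠ 0) {r : ℝ≥0∞} (hr : r = k) {f : Ω → E}
    (hf : MemLp f r P) : ‖hf.toLp f‖ ^ k = ∫ ω, ‖f ω‖ ^ k ∂P := by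
  subst hr
  have h0 : 0 ≤ ∫ ω, ‖f ω‖ ^ k ∂P := integral_nonneg fun _ => by positivity
  rw [Lp.norm_toLp, hf.eLpNorm_eq_integral_rpow_norm (by exact_mod_cast hk) (by simp),
    ENNReal.toReal_ofReal (by positivity)]
  simp only [ENNReal.toReal_natCast, Real.rpow_natCast]
  rw [Real.rpow_inv_natCast_pow h0 hk]

variable {H : Type*} [NormedAddCommGroup H] [InnerProductSpace ℂ H]

variable (H) in
/-- The inner product as a continuous real bilinear map. -/
def innerRealCLM : H →L[ℝ] H →L[ℝ] ℂ :=
  (isBoundedBilinearMap_inner (𝕜 := ℂ) (E := H)).toContinuousLinearMap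

variable (P) in
/-- The pointwise inner product `L⁴ × L⁴ → L²`. -/
def lpInner (u v : Lp H 4 P) : Lp ℂ 2 P := (innerRealCLM H).holder 2 u v

variable (P) in
/-- The pointwise product `L⁴ × L⁴ → L²`. -/
def lpMul (f g : Lp ℂ 4 P) : Lp ℂ 2 P := (ContinuousLinearMap.mul ℝ ℂ).holder 2 f g

theorem coeFn_lpInner (u v : Lp H 4 P) :
    lpInner P u v =ᵐ[P] fun ω => inner ℂ (u ω) (v ω) :=
  (innerRealCLM H).coeFn_holder u v

theorem coeFn_lpMul (f g : Lp ℂ 4 P) : lpMul P f g =ᵐ[P] fun ω => f ω * g ω :=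
  (ContinuousLinearMap.mul ℝ ℂ).coeFn_holder f g

theorem continuous_lpInner : Continuous fun q : Lp H 4 P × Lp H 4 P => lpInner P q.1 q.2 :=
  ((innerRealCLM H).holderL P 4 4 2).continuous₂

theorem continuous_lpMul : Continuous fun q : Lp ℂ 4 P × Lp ℂ 4 P => lpMul P q.1 q.2 :=
  ((ContinuousLinearMap.mul ℝ ℂ).holderL P 4 4 2).continuous₂

/-- Writes a quartic integrand as an `L²` inner product of bilinear expressions `L⁴ × L⁴ → L²`; this
gives both its integrability and its continuity in the `L⁴` arguments. -/
theorem inner_lpInner_ae (f : Lp ℂ 4 P) (u : Lp H 4 P) :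
    (fun ω => inner ℂ (lpInner P f f ω) (lpInner P u u ω))
      =ᵐ[P] fun ω => (‖u ω‖ : ℂ) ^ 2 * (‖f ω‖ : ℂ) ^ 2 := by
  filter_upwards [coeFn_lpInner f f, coeFn_lpInner u u] with ω h1 h2
  rw [h1, h2, inner_self_eq_norm_sq_to_K, inner_self_eq_norm_sq_to_K, RCLike.inner_apply]
  simp

theorem inner_lpMul_ae (f : Lp ℂ 4 P) (u v : Lp H 4 P) :
    (fun ω => inner ℂ (lpMul P f f ω) (lpInner P v u ω))
      =ᵐ[P] fun ω => inner ℂ (v ω) (u ω) * starRingEnd ℂ (f ω) ^ 2 := by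
  filter_upwards [coeFn_lpMul f f, coeFn_lpInner v u] with ω h1 h2
  rw [h1, h2, RCLike.inner_apply, map_mul, sq]

variable [IsProbabilityMeasure P]

/-- The inclusion of `L⁴` in `L²`. -/
def lpFourToTwo (f : Lp E 4 P) : Lp E 2 P :=
  ⟨f.1, Lp.antitone (by norm_num) f.2⟩

theorem coeFn_lpFourToTwo (f : Lp E 4 P) : (lpFourToTwo f : Ω → E) = f := rfl

theorem continuous_lpFourToTwo : Continuous (lpFourToTwo : Lp E 4 P → Lp E 2 P) := by
  refine LipschitzWith.continuous (K := 1) (LipschitzWith.of_dist_le_mul fun f g => ?_)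
  rw [NNReal.coe_one, one_mul, dist_eq_norm, dist_eq_norm]
  have : lpFourToTwo f - lpFourToTwo g = lpFourToTwo (f - g) := rfl
  rw [this, Lp.norm_def, Lp.norm_def]
  exact ENNReal.toReal_mono (Lp.eLpNorm_ne_top _)
    (eLpNorm_le_eLpNorm_of_exponent_le (by norm_num) (Lp.aestronglyMeasurable _))

end LFour


/-! ### Passing to the limit within a chaos. -/

section Limit

variable {ι : Type*} {H : Type*} [NormedAddCommGroup H] [InnerProductSpace ℂ H]
  {Ω : Type*} [MeasurableSpace Ω] {P : Measure Ω} {Z : H → Ω → ℂ} {e : ι → H}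

theorem exists_le_of_pow_four_le {C : ℝ} (hC : 0 ≤ C) :
    ∃ K : ℝ, 0 ≤ K ∧ ∀ x y : ℝ, 0 ≤ y → x ^ 4 ≤ C * (y ^ 2) ^ 2 → x ≤ K * y := by
  -- `C ≤ (1 + C)⁴` avoids taking a fourth root.
  refine ⟨1 + C, by positivity, fun x y hy h => ?_⟩
  refine le_of_pow_le_pow_left₀ (n := 4) (by norm_num) (by positivity) (h.trans ?_)
  have h1 : C ≤ (1 + C) ^ 4 := by
    have : (1 + C) ^ 1 ≤ (1 + C) ^ 4 := pow_le_pow_right₀ (by linarith) (by norm_num)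
    linarith
  calc C * (y ^ 2) ^ 2 = C * y ^ 4 := by ring
    _ ≤ (1 + C) ^ 4 * y ^ 4 := by gcongr
    _ = ((1 + C) * y) ^ 4 := by ring

theorem exists_norm_polyLp_le (hZ : IsComplexIsonormal Z P) (he : Orthonormal ℂ e) (m n : ℕ) :
    ∃ K : ℝ, 0 ≤ K ∧ ∀ p ∈ chaos ι m n,
      ‖polyLp hZ e 4 (by simp) p‖ ≤ K * ‖polyLp hZ e 2 (by simp) p‖ := by
  obtain ⟨C, hC, h⟩ := exists_hypercontractive (ι := ι) hZ he _ m n rfl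
  obtain ⟨K, hK, hK'⟩ := exists_le_of_pow_four_le hC
  refine ⟨K, hK, fun p hp => hK' _ _ (norm_nonneg _) ?_⟩
  have h4 := norm_toLp_pow (k := 4) (by norm_num) rfl (memLp_polyVar hZ e p (r := 4) (by simp))
  have h2 := norm_toLp_pow (k := 2) (by norm_num) rfl (memLp_polyVar hZ e p (r := 2) (by simp))
  have := h p hp
  rw [← h4, ← h2] at this
  exact this

theorem exists_norm_polyGradLp_le (hZ : IsComplexIsonormal Z P) (he : Orthonormal ℂ e)
    (m n : ℕ) : ∃ K : ℝ, 0 ≤ K ∧ ∀ p ∈ chaos ι m n,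
      ‖polyGradLp hZ e 4 (by simp) p‖ ≤ K * ‖polyLp hZ e 2 (by simp) p‖ := by
  obtain ⟨C, hC, h⟩ := exists_hypercontractive_polyGrad (ι := ι) hZ he m n
  obtain ⟨K, hK, hK'⟩ := exists_le_of_pow_four_le hC
  refine ⟨K, hK, fun p hp => hK' _ _ (norm_nonneg _) ?_⟩
  have h4 := norm_toLp_pow (k := 4) (by norm_num) rfl (memLp_polyGrad hZ e p (r := 4) (by simp))
  have h2 := norm_toLp_pow (k := 2) (by norm_num) rfl (memLp_polyVar hZ e p (r := 2) (by simp))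
  have := h p hp
  rw [← h4, ← h2] at this
  exact this

theorem polyLp_polyBar (hZ : IsComplexIsonormal Z P) (e : ι → H) (r : ℝ≥0∞) (hr : r ≠ ∞)
    (p : ConjPoly ι) : polyLp hZ e r hr (polyBar p) = star (polyLp hZ e r hr p) := by
  refine Lp.ext ?_
  filter_upwards [coeFn_polyLp hZ e r hr (polyBar p), coeFn_polyLp hZ e r hr p,
    Lp.coeFn_star (polyLp hZ e r hr p)] with ω h1 h2 h3
  rw [h1, h3, Pi.star_apply, h2]
  simp [polyVar]

theorem norm_star_lp {r : ℝ≥0∞} (f : Lp ℂ r P) : ‖star f‖ = ‖f‖ := by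
  have h : ∀ᵐ ω ∂P, ‖(star f : Lp ℂ r P) ω‖ = ‖f ω‖ := by
    filter_upwards [Lp.coeFn_star f] with ω hω
    rw [hω]; simp
  exact le_antisymm (Lp.norm_le_norm_of_ae_le (h.mono fun _ => le_of_eq))
    (Lp.norm_le_norm_of_ae_le (h.mono fun _ hω => hω.ge))

theorem continuous_star_lp {r : ℝ≥0∞} [Fact (1 ≤ r)] :
    Continuous (star : Lp ℂ r P → Lp ℂ r P) := by
  refine LipschitzWith.continuous (K := 1) (LipschitzWith.of_dist_le_mul fun f g => ?_)
  rw [NNReal.coe_one, one_mul, dist_eq_norm, dist_eq_norm]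
  refine Lp.norm_le_norm_of_ae_le ?_
  filter_upwards [Lp.coeFn_star f, Lp.coeFn_star g, Lp.coeFn_sub f g,
    Lp.coeFn_sub (star f) (star g)] with ω h1 h2 h3 h4
  rw [h3, h4, Pi.sub_apply, Pi.sub_apply, h1, h2, Pi.star_apply, Pi.star_apply, ← star_sub,
    norm_star]

theorem cauchySeq_of_dist_le {X Y : Type*} [PseudoMetricSpace X] [PseudoMetricSpace Y]
    {x : ℕ → X} {y : ℕ → Y} (hx : CauchySeq x) {K : ℝ} (hK : 0 ≤ K)
    (h : ∀ k l, dist (y k) (y l) ≤ K * dist (x k) (x l)) : CauchySeq y := by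
  rw [Metric.cauchySeq_iff] at hx ⊢
  intro ε hε
  obtain ⟨N, hN⟩ := hx (ε / (K + 1)) (by positivity)
  refine ⟨N, fun k hk l hl => (h k l).trans_lt ?_⟩
  calc K * dist (x k) (x l) ≤ (K + 1) * dist (x k) (x l) := by
        gcongr; linarith
    _ < (K + 1) * (ε / (K + 1)) := by
        have := hN k hk l hl
        gcongr
    _ = ε := by field_simp

/-- The fourth moment identity, in terms of elements of `L⁴`. -/
def FourthMoment (m : ℕ) (f : Lp ℂ 4 P) (u v : Lp H 4 P) : Prop :=
  (m : ℂ) * inner ℂ (lpInner P f f) (lpInner P f f)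
    = 2 * inner ℂ (lpInner P f f) (lpInner P u u) + inner ℂ (lpMul P f f) (lpInner P v u)

/-- The integral form is the one verified on polynomials; the inner product form is visibly closed
in `L⁴`. -/
theorem fourthMoment_iff {m : ℕ} {f : Lp ℂ 4 P} {u v : Lp H 4 P} :
    FourthMoment m f u v ↔ (m : ℂ) * ∫ ω, (‖f ω‖ : ℂ) ^ 4 ∂P
      = ∫ ω, (2 * (‖u ω‖ : ℂ) ^ 2 * (‖f ω‖ : ℂ) ^ 2
          + inner ℂ (v ω) (u ω) * starRingEnd ℂ (f ω) ^ 2) ∂P := by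
  have i1 := (L2.integrable_inner (𝕜 := ℂ) (lpInner P f f) (lpInner P u u)).congr
    (inner_lpInner_ae f u)
  have i2 := (L2.integrable_inner (𝕜 := ℂ) (lpMul P f f) (lpInner P v u)).congr
    (inner_lpMul_ae f u v)
  have e1 : ∫ ω, (‖f ω‖ : ℂ) ^ 4 ∂P = inner ℂ (lpInner P f f) (lpInner P f f) := by
    rw [L2.inner_def, integral_congr_ae (inner_lpInner_ae f f)]
    congr 1; ext ω; ring
  have e2 : ∫ ω, (2 * (‖u ω‖ : ℂ) ^ 2 * (‖f ω‖ : ℂ) ^ 2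
      + inner ℂ (v ω) (u ω) * starRingEnd ℂ (f ω) ^ 2) ∂P
      = 2 * inner ℂ (lpInner P f f) (lpInner P u u)
        + inner ℂ (lpMul P f f) (lpInner P v u) := by
    rw [L2.inner_def, L2.inner_def, integral_congr_ae (inner_lpInner_ae f u),
      integral_congr_ae (inner_lpMul_ae f u v), ← integral_const_mul,
      ← integral_add (i1.const_mul 2) i2]
    simp only [mul_assoc]
  rw [e1, e2, FourthMoment]

theorem isClosed_fourthMoment (m : ℕ) :
    IsClosed {q : Lp ℂ 4 P × Lp H 4 P × Lp H 4 P | FourthMoment m q.1 q.2.1 q.2.2} := by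
  have c1 : Continuous fun q : Lp ℂ 4 P × Lp H 4 P × Lp H 4 P => lpInner P q.1 q.1 :=
    continuous_lpInner.comp (by fun_prop : Continuous fun q : Lp ℂ 4 P × Lp H 4 P × Lp H 4 P =>
      (q.1, q.1))
  have c2 : Continuous fun q : Lp ℂ 4 P × Lp H 4 P × Lp H 4 P => lpInner P q.2.1 q.2.1 :=
    continuous_lpInner.comp (by fun_prop : Continuous fun q : Lp ℂ 4 P × Lp H 4 P × Lp H 4 P =>
      (q.2.1, q.2.1))
  have c3 : Continuous fun q : Lp ℂ 4 P × Lp H 4 P × Lp H 4 P => lpInner P q.2.2 q.2.1 :=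
    continuous_lpInner.comp (by fun_prop : Continuous fun q : Lp ℂ 4 P × Lp H 4 P × Lp H 4 P =>
      (q.2.2, q.2.1))
  have c4 : Continuous fun q : Lp ℂ 4 P × Lp H 4 P × Lp H 4 P => lpMul P q.1 q.1 :=
    continuous_lpMul.comp (by fun_prop : Continuous fun q : Lp ℂ 4 P × Lp H 4 P × Lp H 4 P =>
      (q.1, q.1))
  exact isClosed_eq (continuous_const.mul (c1.inner c1))
    ((continuous_const.mul (c1.inner c2)).add (c4.inner c3))

theorem FourthMoment.of_tendsto {m : ℕ} {f : ℕ → Lp ℂ 4 P} {u v : ℕ → Lp H 4 P}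
    {f₀ : Lp ℂ 4 P} {u₀ v₀ : Lp H 4 P} (hf : Filter.Tendsto f Filter.atTop (nhds f₀))
    (hu : Filter.Tendsto u Filter.atTop (nhds u₀)) (hv : Filter.Tendsto v Filter.atTop (nhds v₀))
    (h : ∀ k, FourthMoment m (f k) (u k) (v k)) : FourthMoment m f₀ u₀ v₀ := by
  have ht := hf.prodMk_nhds (hu.prodMk_nhds hv)
  have hcl := isClosed_fourthMoment (P := P) (H := H) m
  have hmem := hcl.mem_of_tendsto ht (Filter.Eventually.of_forall h)
  exact hmem

theorem fourthMoment_polyLp (hZ : IsComplexIsonormal Z P) (he : Orthonormal ℂ e) {m n : ℕ}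
    {p : ConjPoly ι} (hp : p ∈ chaos ι m n) :
    FourthMoment m (polyLp hZ e 4 (by simp) p) (polyGradLp hZ e 4 (by simp) p)
      (polyGradLp hZ e 4 (by simp) (polyBar p)) := by
  rw [fourthMoment_iff]
  have h1 := coeFn_polyLp hZ e 4 (by simp) p
  have e1 : ∫ ω, (‖polyLp hZ e 4 (by simp) p ω‖ : ℂ) ^ 4 ∂P
      = ∫ ω, (‖polyVar Z e p ω‖ : ℂ) ^ 4 ∂P :=
    integral_congr_ae (h1.mono fun ω h => by simp only [h])
  rw [e1, fourth_moment_polyVar hZ he hp]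
  refine integral_congr_ae ?_
  filter_upwards [h1, coeFn_polyGradLp hZ e 4 (by simp) p,
    coeFn_polyGradLp hZ e 4 (by simp) (polyBar p)] with ω h1 h2 h3
  rw [h1, h2, h3]

/-- Elements of a Wiener chaos lie in `L⁴`, are Malliavin differentiable with derivative in `L⁴`,
and satisfy the fourth moment identity. -/
theorem exists_of_mem_closure_chaos [IsProbabilityMeasure P] [CompleteSpace H] (hZ : IsComplexIsonormal Z P)
    (he : Orthonormal ℂ e) {m n : ℕ} {F : Lp ℂ 2 P}
    (hF : F ∈ ((chaos ι m n).map (polyLp hZ e 2 (by simp))).topologicalClosure) :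
    ∃ (f : Lp ℂ 4 P) (u v : Lp H 4 P), lpFourToTwo f = F ∧
      HasMalliavinDeriv Z P F (lpFourToTwo u) ∧
      HasMalliavinDeriv Z P (star F) (lpFourToTwo v) ∧ FourthMoment m f u v := by
  obtain ⟨x, hx, hxF⟩ := mem_closure_iff_seq_limit.1 hF
  choose p hp hpx using hx
  obtain rfl : (fun k => polyLp hZ e 2 (by simp) (p k)) = x := funext hpx
  obtain ⟨K₁, hK₁, h₁⟩ := exists_norm_polyLp_le (ι := ι) hZ he m n
  obtain ⟨K₂, hK₂, h₂⟩ := exists_norm_polyGradLp_le (ι := ι) hZ he m n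
  obtain ⟨K₃, hK₃, h₃⟩ := exists_norm_polyGradLp_le (ι := ι) hZ he n m
  have hsub : ∀ k l, p k - p l ∈ chaos ι m n := fun k l => sub_mem (hp k) (hp l)
  have hdist : ∀ k l, dist (polyLp hZ e 2 (by simp) (p k)) (polyLp hZ e 2 (by simp) (p l))
      = ‖polyLp hZ e 2 (by simp) (p k - p l)‖ := fun k l => by rw [dist_eq_norm, map_sub]
  -- Differences of the approximants stay in the chaos, so the hypercontractive bounds turn an `L²`
  -- Cauchy sequence into `L⁴` Cauchy sequences.
  have c₁ : CauchySeq fun k => polyLp hZ e 4 (by simp) (p k) :=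
    cauchySeq_of_dist_le hxF.cauchySeq hK₁ fun k l => by
      rw [hdist, dist_eq_norm, ← map_sub]
      exact h₁ _ (hsub k l)
  have c₂ : CauchySeq fun k => polyGradLp hZ e 4 (by simp) (p k) :=
    cauchySeq_of_dist_le hxF.cauchySeq hK₂ fun k l => by
      rw [hdist, dist_eq_norm, ← polyGradLp_sub]
      exact h₂ _ (hsub k l)
  -- Conjugation moves the approximants to the chaos `(n, m)` without changing their `L²` norms.
  have c₃ : CauchySeq fun k => polyGradLp hZ e 4 (by simp) (polyBar (p k)) :=
    cauchySeq_of_dist_le hxF.cauchySeq hK₃ fun k l => by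
      rw [hdist, dist_eq_norm, ← polyGradLp_sub, ← map_sub, ← norm_star_lp (polyLp hZ e 2 _ _),
        ← polyLp_polyBar]
      exact h₃ _ (polyBar_mem_chaos (hsub k l))
  obtain ⟨f, hf⟩ := cauchySeq_tendsto_of_complete c₁
  obtain ⟨u, hu⟩ := cauchySeq_tendsto_of_complete c₂
  obtain ⟨v, hv⟩ := cauchySeq_tendsto_of_complete c₃
  refine ⟨f, u, v, ?_, ?_, ?_, ?_⟩
  -- The inclusion of `L⁴` in `L²` is continuous, so the `L⁴` limit represents the original `F`.
  · exact tendsto_nhds_unique ((continuous_lpFourToTwo.tendsto f).comp hf) hxF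
  · refine mem_closure_of_tendsto
      (hxF.prodMk_nhds ((continuous_lpFourToTwo.tendsto u).comp hu)) (.of_forall fun k => ?_)
    exact mem_smoothGraph_polyVar hZ e (p k)
  · refine mem_closure_of_tendsto (((continuous_star_lp.tendsto F).comp hxF).prodMk_nhds
      ((continuous_lpFourToTwo.tendsto v).comp hv)) (.of_forall fun k => ?_)
    have := mem_smoothGraph_polyVar hZ e (polyBar (p k))
    simp only [Function.comp_apply]
    rw [← polyLp_polyBar]
    exact this
  · exact FourthMoment.of_tendsto hf hu hv fun k => fourthMoment_polyLp hZ he (hp k)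

/-- `malliavinD` is defined by choice; closability makes the choice irrelevant. -/
theorem HasMalliavinDeriv.malliavinD_eq (hZ : IsComplexIsonormal Z P) {F : Lp ℂ 2 P}
    {u : Lp H 2 P} (h : HasMalliavinDeriv Z P F u) : malliavinD Z P F = u := by
  have hex : ∃ u, HasMalliavinDeriv Z P F u := ⟨u, h⟩
  rw [malliavinD, dif_pos hex]
  exact HasMalliavinDeriv.unique hZ hex.choose_spec h

end Limit

end ComplexWiener

end

theorem mainTheorem6 {H : Type*} [NormedAddCommGroup H] [InnerProductSpace ℂ H]
    [CompleteSpace H] [TopologicalSpace.SeparableSpace H]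
    (conj : H ≃ₗᵢ⋆[ℂ] H) (hconj : Function.Involutive conj)
    {ι : Type*} (e : HilbertBasis ι ℂ H)
    {Ω : Type*} [MeasurableSpace Ω] (P : Measure Ω) [IsProbabilityMeasure P]
    (Z : H → Ω → ℂ) (hZ : ComplexWiener.IsComplexIsonormal Z P)
    (m n : ℕ) (hm : 1 ≤ m)
    (f : ComplexWiener.HTensor H (m + n)) (hf : f ∈ ComplexWiener.symKernels H m n)
    (F : Lp ℂ 2 P) (hF : F = ComplexWiener.wienerIto hZ conj e m n f) :
    F ∈ ComplexWiener.malliavinDomain Z P ∧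
    star F ∈ ComplexWiener.malliavinDomain Z P ∧
    Integrable (fun ω => ‖F ω‖ ^ 4) P ∧
    Integrable (fun ω => ‖ComplexWiener.malliavinD Z P F ω‖ ^ 2 * ‖F ω‖ ^ 2) P ∧
    Integrable (fun ω => inner ℂ (ComplexWiener.malliavinD Z P (star F) ω)
      (ComplexWiener.malliavinD Z P F ω) * (starRingEnd ℂ (F ω)) ^ 2) P ∧
    ((∫ ω, ‖F ω‖ ^ 4 ∂P : ℝ) : ℂ) =
      (1 / (m : ℂ)) * ∫ ω,
        (2 * (‖ComplexWiener.malliavinD Z P F ω‖ : ℂ) ^ 2 * (‖F ω‖ : ℂ) ^ 2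
          + inner ℂ (ComplexWiener.malliavinD Z P (star F) ω)
              (ComplexWiener.malliavinD Z P F ω) * (starRingEnd ℂ (F ω)) ^ 2) ∂P := by
  obtain ⟨f, u, v, hfF, hu, hv, hid⟩ := ComplexWiener.exists_of_mem_closure_chaos hZ e.orthonormal
    (hF ▸ ComplexWiener.wienerIto_mem_closure hZ conj e m n f)
  rw [hu.malliavinD_eq hZ, hv.malliavinD_eq hZ]
  -- The inclusion into `L²` keeps the underlying function, so every remaining claim concerns the
  -- `L⁴` elements `f`, `u`, `v`.
  simp only [ComplexWiener.coeFn_lpFourToTwo, ← hfF]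
  refine ⟨⟨_, hfF ▸ hu⟩, ⟨_, hfF ▸ hv⟩, ?_, ?_, ?_, ?_⟩
  · exact (Lp.memLp f).integrable_norm_pow (by simp)
  · have h := ((L2.integrable_inner (𝕜 := ℂ) _ _).congr
      (ComplexWiener.inner_lpInner_ae f u)).norm
    simpa using h
  · exact (L2.integrable_inner (𝕜 := ℂ) _ _).congr (ComplexWiener.inner_lpMul_ae f u v)
  · rw [ComplexWiener.fourthMoment_iff] at hid
    have hm' : (m : ℂ) ≠ 0 := by exact_mod_cast (by omega : m ≠ 0)
    rw [← hid, ← mul_assoc, one_div_mul_cancel hm', one_mul, ← integral_complex_ofReal]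
    push_cast
    rfl
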